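/- Let $A_1,A_2,\dots$ be i.i.d. random variables with values in $(0,\infty)$, let $a=\inf(\operatorname{supp}A_1)\in[0,\infty)$ and $b=\sup(\operatorname{supp}A_1)\in(0,\infty]$, and let $$T_n=A_1^{A_2^{\cdot^{\cdot^{\cdot^{A_n}}}}}.$$ For $c>0$ and $n\ge 1$ write $c\star n=c^{c^{\cdot^{\cdot^{\cdot^{c}}}}}$ ($n$ copies of $c$). Let $W:[-1/e,\infty)\to[-1,\infty)$ be the principal real branch of the Lambert function, that is, $W(z)$ is the unique $w\ge -1$ with $we^w=z$, and define $G:[0,1]\to[0,1]$ by $$G(x)=\begin{cases}x,& x\ge e^{-e},\\ \exp\!\left(W\!\left(\tfrac1{\ln x}\right)\exp\!\left(-\frac1{W(1/\ln x)}\right)\right),& 0<x<e^{-e},\\ 0,& x=0.\end{cases}$$ "Converges" means convergence to a finite real limit. 1. If $[a,b]\subseteq[1,e^{1/e}]$, then $T_n$ converges almost surely. 2. If $a\ge 1$ and $e^{1/e}<b<\infty$, then $$\mathbb E\left[\inf\{n\ge 1: A_n\le e^{1/(e\star n)}\}\right]<\infty\iff T_n\text{ converges almost surely},$$ where $\inf\emptyset=\infty$.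 3. If $b\le 1$ and $a<G(b)$, then $T_n$ converges almost surely. If $b<e^{-e}$ and $a\ge G(b)$, then almost surely the subsequences $(T_{2n})$ and $(T_{2n+1})$ converge to distinct finite limits; in particular $T_n$ diverges by oscillation. 4. If $a<1<b\le\infty$, then $T_n$ converges almost surely. -/

import Mathlib

open MeasureTheory ProbabilityTheory Filter Topology

namespace RandomPowerTower

/-- The power tower of height `n` on the entries `x 0, x 1, …, x (n - 1)`,
`x 0 ^ (x 1 ^ (⋯ ^ x (n - 1)))`; the empty tower is `1`. -/
noncomputable def powerTower : ℕ → (ℕ → ℝ) → ℝ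
  | 0, _ => 1
  | n + 1, x => x 0 ^ powerTower n (fun i => x (i + 1))

/-- Tetration `c ⋆ n = c ^ (c ^ (⋯ ^ c))`, with `n` copies of `c`. -/
noncomputable def star (c : ℝ) (n : ℕ) : ℝ := powerTower n (fun _ => c)

/-- The infimum, in the extended reals, of the support of a measure on the line. -/
noncomputable def suppInf (μ : Measure ℝ) : EReal :=
  sInf ((fun x : ℝ => (x : EReal)) '' μ.support)

/-- The supremum, in the extended reals, of the support of a measure on the line. -/
noncomputable def suppSup (μ : Measure ℝ) : EReal :=
  sSup ((fun x : ℝ => (x : EReal)) '' μ.support)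

/-- The principal real branch of the Lambert function: for `z ≥ -1/e`, the unique `w ≥ -1`
with `w * exp w = z` (values at `z < -1/e` carry no meaning). -/
noncomputable def lambertW (z : ℝ) : ℝ :=
  Function.invFunOn (fun w : ℝ => w * Real.exp w) (Set.Ici (-1)) z

/-- The threshold function on `[0, 1]`. The displayed formula is used on `(0, exp (-e))`; at `0`
the function takes the limit value `0` of that formula. -/
noncomputable def G (x : ℝ) : ℝ :=
  if Real.exp (-Real.exp 1) ≤ x then x
  else if x = 0 then 0
  else Real.exp (lambertW (1 / Real.log x) * Real.exp (-(1 / lambertW (1 / Real.log x))))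

/-- The first index `n ≥ 1` with `Aₙ ≤ exp (1 / (e ⋆ n))`, and `∞` if there is none.
Sequences are indexed from `0`, so that `Aₙ` is `x (n - 1)`. -/
noncomputable def firstSmall (x : ℕ → ℝ) : ENNReal :=
  sInf {k : ENNReal | ∃ n : ℕ, k = ((n + 1 : ℕ) : ENNReal) ∧
    x n ≤ Real.exp (1 / star (Real.exp 1) (n + 1))}

/-- The defining property of `lambertW` on its domain. -/
theorem lambertW_spec {z : ℝ} (hz : -Real.exp (-1) ≤ z) :
    -1 ≤ lambertW z ∧ lambertW z * Real.exp (lambertW z) = z := by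
  have hex : ∃ w ∈ Set.Ici (-1 : ℝ), w * Real.exp w = z := by
    have hc : ContinuousOn (fun w : ℝ => w * Real.exp w) (Set.Icc (-1) (max z 0)) := by fun_prop
    have hle : (-1 : ℝ) ≤ max z 0 := le_trans (by norm_num) (le_max_right z 0)
    have hmem : z ∈ Set.Icc ((-1 : ℝ) * Real.exp (-1)) (max z 0 * Real.exp (max z 0)) := by
      refine ⟨by linarith, ?_⟩
      have h0 : (0 : ℝ) ≤ max z 0 := le_max_right z 0
      have h1 : (1 : ℝ) ≤ Real.exp (max z 0) := Real.one_le_exp h0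
      nlinarith [le_max_left z 0]
    obtain ⟨w, hw, hwz⟩ := intermediate_value_Icc hle hc hmem
    exact ⟨w, hw.1, hwz⟩
  exact ⟨Function.invFunOn_mem hex, Function.invFunOn_eq hex⟩

/-- `G` maps `[0, 1]` to itself. -/
theorem G_mem {x : ℝ} (hx : x ∈ Set.Icc (0 : ℝ) 1) : G x ∈ Set.Icc (0 : ℝ) 1 := by
  unfold G
  split_ifs with h1 h2
  · exact hx
  · simp
  · refine ⟨(Real.exp_pos _).le, Real.exp_le_one_iff.mpr ?_⟩
    have hx0 : 0 < x := lt_of_le_of_ne hx.1 (Ne.symm h2)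
    have hlog : Real.log x < -Real.exp 1 := (Real.log_lt_iff_lt_exp hx0).mpr (not_le.mp h1)
    have he : 0 < Real.exp 1 := Real.exp_pos 1
    have hneg : 1 / Real.log x < 0 := one_div_neg.mpr (by linarith)
    have hge : -Real.exp (-1) ≤ 1 / Real.log x := by
      rw [Real.exp_neg, ← one_div, ← one_div_neg_eq_neg_one_div]
      exact one_div_le_one_div_of_neg_of_le (by linarith) hlog.le
    have hs := (lambertW_spec hge).2
    have hW : lambertW (1 / Real.log x) ≤ 0 := by
      by_contra hpos
      have := mul_pos (not_le.mp hpos) (Real.exp_pos (lambertW (1 / Real.log x)))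
      linarith
    exact mul_nonpos_of_nonpos_of_nonneg hW (Real.exp_pos _).le

end RandomPowerTower

namespace RandomPowerTower

/-! Write `T_n` as the value at `1` of a composition of `n` maps `t ↦ x ^ t`, each monotone or
antitone on `[0, ∞)`. Three mechanisms settle the cases.

Splitting. Suppose one finite pattern of entries forces the tower below a level `c` and another
forces it above `c`, both with positive probability and whatever stands on top. A fixed `y` interior
to the range of the first `n` maps cannot lie on both sides of the image of `c`, so each further
window expels `y` from the range with probability bounded below. Almost surely every rational `y` is
expelled, so a bounded tower has no oscillation (`ae_exists_tendsto_of_splitting`). If `a < 1 < b`,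
single entries split at `c = 1`. If `b ≤ 1` and `a < G b`, alternating entries near `a` and `b`
split, because a fixed point `u` of `t ↦ p ^ b ^ t` with `b ^ u ≤ u` forces `G b ≤ p`
(`log_G_mul_rpow_le`).

Two-cycle. If `b < e ^ (-e)`, there are `v < u` with `b ^ u = v` and `(G b) ^ v = u`. Entries in `[G
b, b]` keep even towers above `u` and odd ones below `v`.

Monotone growth. If `a ≥ 1`, the towers increase, so convergence means boundedness. Entries at most
`e ^ (1 / e)` preserve the bound `e`. For larger finite `b`, a tower rises from its top about as
fast as `e ⋆ k`, and an entry at most `exp (1 / (e ⋆ k))` brings it back to `e`. The expectation in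
question is the series of products of the probabilities `P(A > exp (1 / (e ⋆ k)))`; Borel–Cantelli
turns its finiteness into boundedness, and a counting argument gives the converse. -/

/-- The power tower on the entries `x 0, …, x (n - 1)` with `t` on top. -/
noncomputable def towerOn : ℕ → (ℕ → ℝ) → ℝ → ℝ
  | 0, _, t => t
  | n + 1, x, t => x 0 ^ towerOn n (fun i => x (i + 1)) t

/-! ### Composition and monotonicity of towers with an arbitrary top. -/

theorem powerTower_eq_towerOn (n : ℕ) (x : ℕ → ℝ) : powerTower n x = towerOn n x 1 := by
  induction n generalizing x with
  | zero => rfl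
  | succ n ih => simp only [powerTower, towerOn, ih]

theorem towerOn_add (m n : ℕ) (x : ℕ → ℝ) (t : ℝ) :
    towerOn (m + n) x t = towerOn m x (towerOn n (fun i => x (i + m)) t) := by
  induction m generalizing x with
  | zero => simp [towerOn]
  | succ m ih =>
    rw [Nat.succ_add]
    simp only [towerOn, ih]
    simp only [add_assoc]

theorem towerOn_succ' (n : ℕ) (x : ℕ → ℝ) (t : ℝ) :
    towerOn (n + 1) x t = towerOn n x (x n ^ t) := by
  rw [towerOn_add]
  simp [towerOn]

theorem towerOn_nonneg {x : ℕ → ℝ} (hx : ∀ i, 0 ≤ x i) {t : ℝ} (ht : 0 ≤ t) (n : ℕ) :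
    0 ≤ towerOn n x t := by
  cases n with
  | zero => exact ht
  | succ n => exact Real.rpow_nonneg (hx 0) _

theorem towerOn_monotoneOn_or_antitoneOn {x : ℕ → ℝ} (hx : ∀ i, 0 < x i) (n : ℕ) :
    MonotoneOn (towerOn n x) (Set.Ici 0) ∨ AntitoneOn (towerOn n x) (Set.Ici 0) := by
  induction n generalizing x with
  | zero => exact Or.inl fun _ _ _ _ h => h
  | succ n ih =>
    rcases le_total 1 (x 0) with h1 | h1
    · refine (ih fun i => hx (i + 1)).imp ?_ ?_
      · exact fun h s hs t ht hst => Real.rpow_le_rpow_of_exponent_le h1 (h hs ht hst)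
      · exact fun h s hs t ht hst => Real.rpow_le_rpow_of_exponent_le h1 (h hs ht hst)
    · refine (ih fun i => hx (i + 1)).symm.imp ?_ ?_
      · exact fun h s hs t ht hst =>
          Real.rpow_le_rpow_of_exponent_ge (hx 0) h1 (h hs ht hst)
      · exact fun h s hs t ht hst =>
          Real.rpow_le_rpow_of_exponent_ge (hx 0) h1 (h hs ht hst)

theorem towerOn_mono {x : ℕ → ℝ} (hx : ∀ i, 1 ≤ x i) (n : ℕ) : Monotone (towerOn n x) := by
  induction n generalizing x with
  | zero => exact fun _ _ h => h
  | succ n ih =>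
    exact fun s t h => Real.rpow_le_rpow_of_exponent_le (hx 0) (ih (fun i => hx (i + 1)) h)

theorem one_le_towerOn {x : ℕ → ℝ} (hx : ∀ i, 1 ≤ x i) {t : ℝ} (ht : 1 ≤ t) (n : ℕ) :
    1 ≤ towerOn n x t := by
  induction n generalizing x with
  | zero => exact ht
  | succ n ih =>
    exact Real.one_le_rpow (hx 0) (zero_le_one.trans (ih fun i => hx (i + 1)))

theorem towerOn_one_monotone {x : ℕ → ℝ} (hx : ∀ i, 1 ≤ x i) :
    Monotone fun n => towerOn n x 1 := by
  refine monotone_nat_of_le_succ fun n => ?_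
  rw [towerOn_succ']
  exact towerOn_mono hx n (by simpa using hx n)

theorem measurable_towerOn {Ω : Type*} {m : MeasurableSpace Ω} {X : ℕ → Ω → ℝ} {n : ℕ}
    (hX : ∀ i < n, Measurable (X i)) (t : ℝ) :
    Measurable fun ω => towerOn n (fun i => X i ω) t := by
  induction n generalizing X with
  | zero => exact measurable_const
  | succ n ih =>
    exact (hX 0 n.succ_pos).pow (ih (X := fun i => X (i + 1)) fun i hi => hX _ (by omega))

/-- A tower with entries at least `1` and bounded partial towers converges. -/
theorem exists_tendsto_of_one_le {x : ℕ → ℝ} (hx : ∀ i, 1 ≤ x i) {M : ℝ}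
    (hM : ∀ n, towerOn n x 1 ≤ M) : ∃ l, Tendsto (fun n => towerOn n x 1) atTop (𝓝 l) :=
  ⟨_, tendsto_atTop_ciSup (towerOn_one_monotone hx) ⟨M, by rintro _ ⟨n, rfl⟩; exact hM n⟩⟩

/-- The base `e ^ (1 / e)` has `e` as a fixed point, so the bound `e` reproduces itself. -/
theorem towerOn_le_exp_one {x : ℕ → ℝ}
    (hx : ∀ i, x i ∈ Set.Icc 1 (Real.exp (1 / Real.exp 1))) (n : ℕ) :
    towerOn n x 1 ≤ Real.exp 1 := by
  induction n generalizing x with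
  | zero => exact Real.one_le_exp zero_le_one
  | succ n ih =>
    have h := ih fun i => hx (i + 1)
    have h0 : 0 ≤ towerOn n (fun i => x (i + 1)) 1 :=
      zero_le_one.trans (one_le_towerOn (fun i => (hx (i + 1)).1) le_rfl n)
    calc x 0 ^ towerOn n (fun i => x (i + 1)) 1
        ≤ Real.exp (1 / Real.exp 1) ^ towerOn n (fun i => x (i + 1)) 1 :=
          Real.rpow_le_rpow (zero_le_one.trans (hx 0).1) (hx 0).2 h0
      _ = Real.exp (1 / Real.exp 1 * towerOn n (fun i => x (i + 1)) 1) := by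
          rw [Real.exp_mul]
      _ ≤ Real.exp 1 := by
          rw [Real.exp_le_exp, one_div, inv_mul_le_iff₀ (Real.exp_pos 1), mul_one]
          exact h

/-! ### Tetration of `e` -/

theorem star_exp_succ (n : ℕ) :
    star (Real.exp 1) (n + 1) = Real.exp (star (Real.exp 1) n) := by
  simp only [star, powerTower, Real.exp_one_rpow]

theorem succ_le_star_exp (n : ℕ) : (n : ℝ) + 1 ≤ star (Real.exp 1) n := by
  induction n with
  | zero => simp [star, powerTower]
  | succ n ih =>
    rw [star_exp_succ]
    push_cast
    linarith [Real.add_one_le_exp (star (Real.exp 1) n)]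

theorem star_exp_pos (n : ℕ) : 0 < star (Real.exp 1) n :=
  lt_of_lt_of_le (by positivity) (succ_le_star_exp n)

theorem star_exp_monotone : Monotone (star (Real.exp 1)) := by
  refine monotone_nat_of_le_succ fun n => ?_
  rw [star_exp_succ]
  linarith [Real.add_one_le_exp (star (Real.exp 1) n)]

/-- Growth: entries at most `b` raise the square root of a large tetration by at most one step. -/
theorem towerOn_le_sqrt_star {b : ℝ} (hb : 1 ≤ b) {c : ℕ}
    (hc : 4 * Real.log b ^ 2 ≤ star (Real.exp 1) c) {x : ℕ → ℝ}
    (hx : ∀ i, x i ∈ Set.Icc 1 b) (j : ℕ) :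
    towerOn j x √(star (Real.exp 1) c) ≤ √(star (Real.exp 1) (j + c)) := by
  induction j generalizing x with
  | zero => simp [towerOn]
  | succ j ih =>
    have h := ih fun i => hx (i + 1)
    set s := star (Real.exp 1) (j + c) with hs
    have hs0 : 0 < s := star_exp_pos _
    have hsc : 4 * Real.log b ^ 2 ≤ s := hc.trans (star_exp_monotone (by omega))
    have hl : 0 ≤ Real.log b := Real.log_nonneg hb
    have hl2 : 2 * Real.log b ≤ √s := by
      apply Real.le_sqrt_of_sq_le
      linarith [mul_pow 2 (Real.log b) 2]
    have h0 : 0 ≤ towerOn j (fun i => x (i + 1)) √(star (Real.exp 1) c) :=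
      towerOn_nonneg (fun i => zero_le_one.trans (hx _).1) (Real.sqrt_nonneg _) j
    calc x 0 ^ towerOn j (fun i => x (i + 1)) √(star (Real.exp 1) c)
        ≤ b ^ √s :=
          (Real.rpow_le_rpow (zero_le_one.trans (hx 0).1) (hx 0).2 h0).trans
            (Real.rpow_le_rpow_of_exponent_le hb h)
      _ = Real.exp (Real.log b * √s) := Real.rpow_def_of_pos (by linarith) _
      -- The square root leaves room for the factor `log b`: it is at most `√s / 2`, and `exp (s /
      -- 2)` is the square root of the next tetration.
      _ ≤ Real.exp (s / 2) := by
          rw [Real.exp_le_exp]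
          nlinarith [Real.sq_sqrt hs0.le, Real.sqrt_nonneg s]
      _ = √(star (Real.exp 1) (j + 1 + c)) := by
          rw [Nat.add_right_comm, star_exp_succ, ← hs, Real.exp_half]

/-- If from some level on every window contains an entry small enough to bring the tower above it
down, the towers are bounded. -/
theorem exists_towerOn_le_of_small {b : ℝ} (hb : 1 ≤ b) {c : ℕ}
    (hc : 4 * Real.log b ^ 2 ≤ star (Real.exp 1) c)
    (hc' : Real.exp 1 ^ 2 ≤ star (Real.exp 1) c) {x : ℕ → ℝ}
    (hx : ∀ i, x i ∈ Set.Icc 1 b) {n₀ : ℕ}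
    (h : ∀ n ≥ n₀, ∃ j < n, x (n - 1 - j) ≤ Real.exp (1 / star (Real.exp 1) (j + c + 1))) :
    ∃ M, ∀ n, towerOn n x 1 ≤ M := by
  set H := √(star (Real.exp 1) c) with hH
  have hx1 : ∀ i, 1 ≤ x i := fun i => (hx i).1
  have heH : Real.exp 1 ≤ H := Real.le_sqrt_of_sq_le hc'
  -- Cutting at the small entry, everything from it upwards is at most `e ≤ H`, so a shorter tower
  -- with the same top `H` dominates. Descend until the height is at most `n₀`.
  have key : ∀ n, ∃ p ≤ n₀, towerOn n x H ≤ towerOn p x H := by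
    intro n
    induction n using Nat.strong_induction_on with
    | _ n ih =>
      rcases le_or_gt n n₀ with hn | hn
      · exact ⟨n, hn, le_rfl⟩
      · obtain ⟨j, hj, hxj⟩ := h n hn.le
        obtain ⟨p, hp, hpn⟩ := ih (n - 1 - j) (by omega)
        refine ⟨p, hp, le_trans ?_ hpn⟩
        have hn' : n = (n - 1 - j) + (1 + j) := by omega
        conv_lhs => rw [hn', towerOn_add]
        apply towerOn_mono hx1
        rw [towerOn_add]
        simp only [towerOn, zero_add, add_assoc]
        set q := n - 1 - j
        have hU : towerOn j (fun i => x (i + (1 + q))) H ≤ star (Real.exp 1) (j + c + 1) := by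
          refine (towerOn_le_sqrt_star hb hc (fun i => hx _) j).trans ?_
          refine le_trans ?_ (star_exp_monotone (Nat.le_succ _))
          rw [Real.sqrt_le_left (star_exp_pos _).le]
          have := succ_le_star_exp (j + c)
          have h0 : (0 : ℝ) ≤ ((j + c : ℕ) : ℝ) := Nat.cast_nonneg _
          nlinarith
        have hU0 : 0 ≤ towerOn j (fun i => x (i + (1 + q))) H :=
          towerOn_nonneg (fun i => zero_le_one.trans (hx1 _)) (Real.sqrt_nonneg _) j
        refine le_trans ?_ heH
        calc x q ^ towerOn j (fun i => x (i + (1 + q))) H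
            ≤ Real.exp (1 / star (Real.exp 1) (j + c + 1)) ^
                towerOn j (fun i => x (i + (1 + q))) H :=
              Real.rpow_le_rpow (zero_le_one.trans (hx1 _)) hxj hU0
          _ = Real.exp (1 / star (Real.exp 1) (j + c + 1) *
                towerOn j (fun i => x (i + (1 + q))) H) := by rw [Real.exp_mul]
          _ ≤ Real.exp 1 := by
              rw [Real.exp_le_exp, one_div, inv_mul_le_iff₀ (star_exp_pos _), mul_one]
              exact hU
  -- The sum stands in for a maximum of finitely many nonnegative towers.
  refine ⟨∑ p ∈ Finset.range (n₀ + 1), towerOn p x H, fun n => ?_⟩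
  obtain ⟨p, hp, hpn⟩ := key n
  refine (towerOn_mono hx1 n ((Real.one_le_exp zero_le_one).trans heH)).trans (hpn.trans ?_)
  exact Finset.single_le_sum (f := fun p => towerOn p x H)
    (fun i _ => towerOn_nonneg (fun i => zero_le_one.trans (hx1 i)) (Real.sqrt_nonneg _) i)
    (Finset.mem_range.mpr (by omega))

/-- Entries above a fixed `β > e ^ (1 / e)` multiply the height by `e * log β > 1` each. -/
theorem pow_mul_le_towerOn {β : ℝ} (hβ : 1 ≤ β) {x : ℕ → ℝ} {n : ℕ} {t : ℝ} (ht : 0 ≤ t)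
    (hx : ∀ i < n, β < x i) :
    (Real.exp 1 * Real.log β) ^ n * t ≤ towerOn n x t := by
  induction n generalizing x with
  | zero => simp [towerOn]
  | succ n ih =>
    have h := ih (x := fun i => x (i + 1)) fun i hi => hx _ (by omega)
    have hr : 0 ≤ Real.exp 1 * Real.log β :=
      mul_nonneg (Real.exp_pos 1).le (Real.log_nonneg hβ)
    set u := towerOn n (fun i => x (i + 1)) t with hu
    have hu0 : 0 ≤ u := le_trans (by positivity) h
    calc (Real.exp 1 * Real.log β) ^ (n + 1) * t
        = Real.exp 1 * Real.log β * ((Real.exp 1 * Real.log β) ^ n * t) := by ring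
      _ ≤ Real.exp 1 * Real.log β * u := by gcongr
      _ = Real.exp 1 * (Real.log β * u) := by ring
      _ ≤ Real.exp (Real.log β * u) := by
          -- This is `e * y ≤ exp y` with `y = log β * u`.
          have := Real.add_one_le_exp (Real.log β * u - 1)
          have h2 : Real.exp (Real.log β * u) = Real.exp 1 * Real.exp (Real.log β * u - 1) := by
            rw [← Real.exp_add]; ring_nf
          rw [h2]
          gcongr
          linarith
      _ = β ^ u := (Real.rpow_def_of_pos (by linarith) _).symm
      _ ≤ x 0 ^ u := Real.rpow_le_rpow (by linarith) (hx 0 n.succ_pos).le hu0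

/-- Entries above the thresholds `exp (1 / (e ⋆ k))` keep a high tower high. -/
theorem le_towerOn_of_large {K : ℝ} (hK : 3 ≤ K) {x : ℕ → ℝ} {m : ℕ} {t : ℝ}
    (ht : K * star (Real.exp 1) 1 ^ 2 ≤ t)
    (hx : ∀ k < m, Real.exp (1 / star (Real.exp 1) (k + 1)) < x (m - 1 - k)) :
    K * star (Real.exp 1) (m + 1) ^ 2 ≤ towerOn m x t := by
  induction m generalizing x with
  | zero => simpa [towerOn] using ht
  | succ m ih =>
    have h := ih (x := fun i => x (i + 1)) fun k hk => by
      have := hx k (by omega)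
      rwa [show m + 1 - 1 - k = m - 1 - k + 1 by omega] at this
    have h0 := hx m (by omega)
    rw [show m + 1 - 1 - m = 0 by omega] at h0
    set u := towerOn m (fun i => x (i + 1)) t with hu
    set y := star (Real.exp 1) (m + 1) with hy
    have hy0 : 0 < y := star_exp_pos _
    have hy2 : 2 ≤ y := by
      have := succ_le_star_exp (m + 1)
      push_cast at this
      linarith [Nat.cast_nonneg (α := ℝ) m]
    have hu0 : 0 ≤ u := le_trans (by positivity) h
    calc K * star (Real.exp 1) (m + 1 + 1) ^ 2 = K * Real.exp (2 * y) := by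
          rw [star_exp_succ, ← hy, ← Real.exp_nat_mul]; norm_num
      -- The square in the invariant pays for the division by `y` in the exponent: `K * y ^ 2 / y =
      -- (K - 2) * y + 2 * y`. With `K ≥ 3` and `y ≥ 2`, the first summand regenerates `K`.
      _ ≤ Real.exp ((K - 2) * y) * Real.exp (2 * y) := by
          gcongr
          have := Real.add_one_le_exp ((K - 2) * y)
          nlinarith
      _ = Real.exp (1 / y * (K * y ^ 2)) := by
          rw [← Real.exp_add]; congr 1; field_simp; ring
      _ ≤ Real.exp (1 / y * u) := by gcongr
      _ = Real.exp (1 / y) ^ u := by rw [Real.exp_mul]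
      _ ≤ x 0 ^ u := Real.rpow_le_rpow (Real.exp_pos _).le h0.le hu0

/-! ### Straddling and independence -/

/-- `y` lies strictly between `p` and `q`, in either order. -/
def Straddles (y p q : ℝ) : Prop := p < y ∧ y < q ∨ q < y ∧ y < p

theorem Straddles.widen {f : ℝ → ℝ} (hf : MonotoneOn f (Set.Ici 0) ∨ AntitoneOn f (Set.Ici 0))
    {y lo hi p q : ℝ} (hlo : 0 ≤ lo) (hp : p ∈ Set.Icc lo hi) (hq : q ∈ Set.Icc lo hi)
    (h : Straddles y (f p) (f q)) : Straddles y (f lo) (f hi) := by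
  have hp0 : p ∈ Set.Ici (0 : ℝ) := hlo.trans hp.1
  have hq0 : q ∈ Set.Ici (0 : ℝ) := hlo.trans hq.1
  have hh0 : hi ∈ Set.Ici (0 : ℝ) := hlo.trans (hp.1.trans hp.2)
  rcases hf with hf | hf
  · have h1 := hf hlo hp0 hp.1
    have h2 := hf hp0 hh0 hp.2
    have h3 := hf hlo hq0 hq.1
    have h4 := hf hq0 hh0 hq.2
    left
    rcases h with h | h <;> constructor <;> linarith
  · have h1 := hf hlo hp0 hp.1
    have h2 := hf hp0 hh0 hp.2
    have h3 := hf hlo hq0 hq.1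
    have h4 := hf hq0 hh0 hq.2
    right
    rcases h with h | h <;> constructor <;> linarith

/-- The values at `0 ≤ c ≤ d` come in order, so `y` fits into only one of the two gaps. This makes
the two bad events of the splitting argument disjoint. -/
theorem not_straddles_of_straddles {f : ℝ → ℝ}
    (hf : MonotoneOn f (Set.Ici 0) ∨ AntitoneOn f (Set.Ici 0)) {y c d : ℝ} (hc : 0 ≤ c)
    (hd : c ≤ d) (h : Straddles y (f 0) (f c)) : ¬ Straddles y (f c) (f d) := by
  have h0 : (0 : ℝ) ∈ Set.Ici (0 : ℝ) := le_refl (0 : ℝ)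
  intro h'
  rcases hf with hf | hf
  · have h1 := hf h0 hc hc
    have h2 := hf hc (hc.trans hd) hd
    rcases h with h | h <;> rcases h' with h' | h' <;> linarith [h.1, h.2, h'.1, h'.2]
  · have h1 := hf h0 hc hc
    have h2 := hf hc (hc.trans hd) hd
    rcases h with h | h <;> rcases h' with h' | h' <;> linarith [h.1, h.2, h'.1, h'.2]

section Probability

variable {Ω : Type*}

theorem measurableSet_straddles {m : MeasurableSpace Ω} {f g : Ω → ℝ} (hf : Measurable f)
    (hg : Measurable g) (y : ℝ) : MeasurableSet {ω | Straddles y (f ω) (g ω)} :=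
  ((measurableSet_lt hf measurable_const).inter (measurableSet_lt measurable_const hg)).union
    ((measurableSet_lt hg measurable_const).inter (measurableSet_lt measurable_const hf))

/-- The σ-algebra generated by the variables with index in `S`. -/
abbrev sigmaOf (A : ℕ → Ω → ℝ) (S : Set ℕ) : MeasurableSpace Ω :=
  ⨆ i ∈ S, MeasurableSpace.comap (A i) inferInstance

theorem measurable_sigmaOf {A : ℕ → Ω → ℝ} {S : Set ℕ} {i : ℕ} (hi : i ∈ S) :
    Measurable[sigmaOf A S] (A i) :=
  (comap_measurable (A i)).mono (le_iSup₂_of_le i hi le_rfl) le_rfl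

theorem measurableSet_window {m : MeasurableSpace Ω} {X : ℕ → Ω → ℝ} {n : ℕ}
    (hX : ∀ j < n, Measurable (X j)) {K : ℕ → Set ℝ} (hK : ∀ j, MeasurableSet (K j)) :
    MeasurableSet {ω | ∀ j < n, X j ω ∈ K j} := by
  have : {ω | ∀ j < n, X j ω ∈ K j} = ⋂ j, ⋂ (_ : j < n), X j ⁻¹' K j := by
    ext ω; simp
  rw [this]
  exact MeasurableSet.iInter fun j => MeasurableSet.iInter fun hj => hX j hj (hK j)

/-- The event that `y` is strictly inside the range of the first `n` maps. -/
def straddleSet (A : ℕ → Ω → ℝ) (n : ℕ) (y : ℝ) : Set Ω :=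
  {ω | ∃ m : ℕ, Straddles y (towerOn n (fun i => A i ω) 0) (towerOn n (fun i => A i ω) m)}

/-- Natural numbers `m` suffice as upper ends, since the maps are monotone or antitone; the union is
then countable. -/
theorem measurableSet_exists_straddles {m : MeasurableSpace Ω} {X : ℕ → Ω → ℝ} {n : ℕ}
    (hX : ∀ i < n, Measurable (X i)) (y c : ℝ) :
    MeasurableSet {ω | ∃ m : ℕ, Straddles y (towerOn n (fun i => X i ω) c)
      (towerOn n (fun i => X i ω) (c + m))} := by
  rw [Set.ofPred_exists]
  exact MeasurableSet.iUnion fun m =>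
    measurableSet_straddles (measurable_towerOn hX _) (measurable_towerOn hX _) y

theorem measurableSet_straddleSet {m : MeasurableSpace Ω} {X : ℕ → Ω → ℝ} {n : ℕ}
    (hX : ∀ i < n, Measurable (X i)) (y : ℝ) : MeasurableSet (straddleSet X n y) := by
  have := measurableSet_exists_straddles hX y 0
  simpa only [zero_add, straddleSet] using this

/-- Every taller tower takes its value in the range of the first `n` maps. Hence `straddleSet`
shrinks as `n` grows, and crossing `y` infinitely often puts `ω` in all of them. -/
theorem mem_straddleSet_of_straddles {ω : Ω} (hω : ∀ i, 0 < A i ω) {n k l : ℕ} {y s t : ℝ}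
    (hs : 0 ≤ s) (ht : 0 ≤ t)
    (h : Straddles y (towerOn (n + k) (fun i => A i ω) s)
      (towerOn (n + l) (fun i => A i ω) t)) : ω ∈ straddleSet A n y := by
  rw [towerOn_add, towerOn_add] at h
  have hs0 := towerOn_nonneg (x := fun i => A (i + n) ω) (fun i => (hω _).le) hs k
  have ht0 := towerOn_nonneg (x := fun i => A (i + n) ω) (fun i => (hω _).le) ht l
  obtain ⟨m, hm⟩ := exists_nat_ge (max (towerOn k (fun i => A (i + n) ω) s)
    (towerOn l (fun i => A (i + n) ω) t))
  exact ⟨m, h.widen (towerOn_monotoneOn_or_antitoneOn hω n) le_rfl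
    ⟨hs0, (le_max_left _ _).trans hm⟩ ⟨ht0, (le_max_right _ _).trans hm⟩⟩

variable [MeasurableSpace Ω] {P : Measure Ω} {A : ℕ → Ω → ℝ}

theorem sigmaOf_le (hmeas : ∀ n, Measurable (A n)) (S : Set ℕ) : sigmaOf A S ≤ ‹MeasurableSpace Ω› :=
  iSup₂_le fun i _ => (hmeas i).comap_le

theorem measure_inter_sigmaOf (hmeas : ∀ n, Measurable (A n)) (hindep : iIndepFun A P)
    {S T : Set ℕ} (hST : Disjoint S T) {B C : Set Ω} (hB : MeasurableSet[sigmaOf A S] B)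
    (hC : MeasurableSet[sigmaOf A T] C) : P (B ∩ C) = P B * P C :=
  Indep_iff _ _ P |>.mp (indep_iSup_of_disjoint (fun i => (hmeas i).comap_le) hindep.iIndep hST)
    B C hB hC

theorem measure_window (hindep : iIndepFun A P) (hident : ∀ n, IdentDistrib (A n) (A 0) P P)
    (m n : ℕ) {K : ℕ → Set ℝ} (hK : ∀ j, MeasurableSet (K j)) :
    P {ω | ∀ j < n, A (m + j) ω ∈ K j} = ∏ j ∈ Finset.range n, P (A 0 ⁻¹' K j) := by
  have hi : iIndepFun (fun j => A (m + j)) P :=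
    hindep.precomp (g := fun j => m + j) (add_right_injective m)
  have h := hi.measure_inter_preimage_eq_mul (Finset.range n) (sets := K) fun j _ => hK j
  rw [show {ω | ∀ j < n, A (m + j) ω ∈ K j} =
    ⋂ j ∈ Finset.range n, A (m + j) ⁻¹' K j by ext ω; simp, h]
  exact Finset.prod_congr rfl fun j _ => (hident (m + j)).measure_mem_eq (hK j)

/-- Patterns read from the top entry downwards have the same probability, by reflecting the indices
of an i.i.d. window. -/
theorem measure_window_reverse (hindep : iIndepFun A P)
    (hident : ∀ n, IdentDistrib (A n) (A 0) P P)
    (n : ℕ) {K : ℕ → Set ℝ} (hK : ∀ j, MeasurableSet (K j)) :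
    P {ω | ∀ j < n, A (n - 1 - j) ω ∈ K j} = ∏ j ∈ Finset.range n, P (A 0 ⁻¹' K j) := by
  have h := measure_window hindep hident 0 n (K := fun j => K (n - 1 - j)) fun j => hK _
  rw [Finset.prod_range_reflect (fun j => P (A 0 ⁻¹' K j)) n] at h
  rw [← h]
  congr 1
  ext ω
  simp only [zero_add, Set.mem_ofPred_eq]
  constructor
  · intro H j hj
    have := H (n - 1 - j) (by omega)
    rwa [show n - 1 - (n - 1 - j) = j by omega] at this
  · intro H j hj
    have := H (n - 1 - j) (by omega)
    rwa [show n - 1 - (n - 1 - j) = j by omega] at this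

/-! ### The support of the law -/

theorem ae_mem_Icc_supp (hmeas : Measurable (A 0)) :
    ∀ᵐ ω ∂P, ((A 0 ω : ℝ) : EReal) ∈ Set.Icc (suppInf (P.map (A 0))) (suppSup (P.map (A 0))) := by
  have h : ∀ᵐ z ∂(P.map (A 0)), z ∈ (P.map (A 0)).support := Measure.support_mem_ae
  filter_upwards [ae_of_ae_map hmeas.aemeasurable h] with ω hω
  exact ⟨sInf_le ⟨_, hω, rfl⟩, le_sSup ⟨_, hω, rfl⟩⟩

theorem measure_preimage_Iio_ne_zero (hmeas : Measurable (A 0)) {z : ℝ}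
    (hz : suppInf (P.map (A 0)) < z) : P (A 0 ⁻¹' Set.Iio z) ≠ 0 := by
  obtain ⟨_, ⟨w, hw, rfl⟩, hwz⟩ := sInf_lt_iff.mp hz
  have := (Measure.mem_support_iff_forall w).mp hw (Set.Iio z)
    (Iio_mem_nhds (EReal.coe_lt_coe_iff.mp hwz))
  rw [Measure.map_apply hmeas measurableSet_Iio] at this
  exact this.ne'

theorem measure_preimage_Ioi_ne_zero (hmeas : Measurable (A 0)) {z : ℝ}
    (hz : (z : EReal) < suppSup (P.map (A 0))) : P (A 0 ⁻¹' Set.Ioi z) ≠ 0 := by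
  obtain ⟨_, ⟨w, hw, rfl⟩, hwz⟩ := lt_sSup_iff.mp hz
  have := (Measure.mem_support_iff_forall w).mp hw (Set.Ioi z)
    (Ioi_mem_nhds (EReal.coe_lt_coe_iff.mp hwz))
  rw [Measure.map_apply hmeas measurableSet_Ioi] at this
  exact this.ne'

theorem ae_forall_mem (hident : ∀ n, IdentDistrib (A n) (A 0) P P) {s : Set ℝ}
    (hs : MeasurableSet s) (h : ∀ᵐ ω ∂P, A 0 ω ∈ s) : ∀ᵐ ω ∂P, ∀ n, A n ω ∈ s :=
  ae_all_iff.mpr fun n => (hident n).symm.ae_mem_snd hs h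

/-! ### Splitting -/

variable [IsProbabilityMeasure P]

/-- If a past event `D` rules out straddling and is excluded by a window pattern, the
probability of straddling drops. -/
theorem measureReal_straddleSet_add_le (hmeas : ∀ n, Measurable (A n))
    (hpos : ∀ᵐ ω ∂P, ∀ n, 0 < A n ω)
    (hindep : iIndepFun A P) (hident : ∀ n, IdentDistrib (A n) (A 0) P P)
    {n N : ℕ} {y : ℝ} {K : ℕ → Set ℝ} (hK : ∀ j, MeasurableSet (K j)) {D : Set Ω}
    (hD : MeasurableSet[sigmaOf A (Set.Iio n)] D)
    (h : ∀ ω, (∀ i, 0 < A i ω) → (∀ j < N, A (n + j) ω ∈ K j) →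
      ω ∈ straddleSet A (n + N) y → ω ∈ D) :
    P.real (straddleSet A (n + N) y) +
      (∏ j ∈ Finset.range N, P.real (A 0 ⁻¹' K j)) * P.real (straddleSet A n y \ D) ≤
      P.real (straddleSet A n y) := by
  set W := {ω | ∀ j < N, A (n + j) ω ∈ K j} with hW
  have hS : MeasurableSet[sigmaOf A (Set.Iio n)] (straddleSet A n y) :=
    measurableSet_straddleSet (m := sigmaOf A (Set.Iio n)) (fun i hi => measurable_sigmaOf hi) y
  have hWm : MeasurableSet[sigmaOf A (Set.Ici n)] W :=
    measurableSet_window (m := sigmaOf A (Set.Ici n))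
      (fun j _ => measurable_sigmaOf (Set.mem_Ici.mpr (Nat.le_add_right n j))) hK
  have hdisj : Disjoint (Set.Iio n) (Set.Ici n) := by
    exact Set.Iio_disjoint_Ici le_rfl
  have hprod := measure_inter_sigmaOf hmeas hindep hdisj (hS.diff hD) hWm
  have hreal : P.real ((straddleSet A n y \ D) ∩ W) =
      (∏ j ∈ Finset.range N, P.real (A 0 ⁻¹' K j)) * P.real (straddleSet A n y \ D) := by
    rw [measureReal_def, hprod, hW, measure_window hindep hident n N hK, ENNReal.toReal_mul,
      ENNReal.toReal_prod, mul_comm]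
    rfl
  rw [← hreal]
  have hm2 : MeasurableSet ((straddleSet A n y \ D) ∩ W) :=
    (sigmaOf_le hmeas _ _ (hS.diff hD)).inter (sigmaOf_le hmeas _ _ hWm)
  have hae : AEDisjoint P (straddleSet A (n + N) y) ((straddleSet A n y \ D) ∩ W) := by
    refine measure_mono_null ?_ (ae_iff.mp hpos)
    intro ω hω hω0
    exact hω.2.1.2 (h ω hω0 hω.2.2 hω.1)
  rw [← measureReal_union₀ hm2.nullMeasurableSet hae]
  refine ENNReal.toReal_mono (measure_ne_top _ _) (measure_mono_ae ?_)
  filter_upwards [hpos] with ω hω hmem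
  rcases hmem with hmem | hmem
  · obtain ⟨m, hm⟩ := hmem
    exact mem_straddleSet_of_straddles hω le_rfl (Nat.cast_nonneg m) hm
  · exact hmem.1.1

/-- Splitting: if one pattern of entries forces the tower below `c` and another one above `c`,
whatever is on top, then the power tower converges as soon as it is bounded. -/
theorem ae_exists_tendsto_of_splitting (hmeas : ∀ n, Measurable (A n))
    (hpos : ∀ᵐ ω ∂P, ∀ n, 0 < A n ω)
    (hindep : iIndepFun A P) (hident : ∀ n, IdentDistrib (A n) (A 0) P P)
    {c : ℝ} (hc : 0 ≤ c) {N : ℕ} {K₁ K₂ : ℕ → Set ℝ}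
    (hK₁ : ∀ j, MeasurableSet (K₁ j)) (hK₂ : ∀ j, MeasurableSet (K₂ j))
    (hP₁ : ∀ j, P (A 0 ⁻¹' K₁ j) ≠ 0) (hP₂ : ∀ j, P (A 0 ⁻¹' K₂ j) ≠ 0)
    (h₁ : ∀ x : ℕ → ℝ, (∀ i, 0 < x i) → (∀ j < N, x j ∈ K₁ j) → ∀ t, 0 ≤ t → towerOn N x t ≤ c)
    (h₂ : ∀ x : ℕ → ℝ, (∀ i, 0 < x i) → (∀ j < N, x j ∈ K₂ j) → ∀ t, 0 ≤ t → c ≤ towerOn N x t)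
    (hbdd : ∀ᵐ ω ∂P, ∃ M, ∀ n, towerOn n (fun i => A i ω) 1 ≤ M) :
    ∀ᵐ ω ∂P, ∃ l, Tendsto (fun n => towerOn n (fun i => A i ω) 1) atTop (𝓝 l) := by
  set δ₁ := ∏ j ∈ Finset.range N, P.real (A 0 ⁻¹' K₁ j) with hδ₁
  set δ₂ := ∏ j ∈ Finset.range N, P.real (A 0 ⁻¹' K₂ j) with hδ₂
  have hδ₁0 : 0 < δ₁ := Finset.prod_pos fun j _ =>
    ENNReal.toReal_pos (hP₁ j) (measure_ne_top _ _)
  have hδ₂0 : 0 < δ₂ := Finset.prod_pos fun j _ =>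
    ENNReal.toReal_pos (hP₂ j) (measure_ne_top _ _)
  set δ := min δ₁ δ₂ with hδ
  have hδ0 : 0 < δ := lt_min hδ₁0 hδ₂0
  -- The events `D₁` and `D₂` put `y` below or above the image of `c` in the ordering of tops. Being
  -- disjoint, they leave `straddleSet A n y` covered by its parts outside `D₁` and outside `D₂`;
  -- averaging the two resulting bounds gives the factor `1 - δ / 2`.
  have hcontr : ∀ n y, P.real (straddleSet A (n + N) y) ≤
      (1 - δ / 2) * P.real (straddleSet A n y) := by
    intro n y
    set D₁ := {ω | Straddles y (towerOn n (fun i => A i ω) 0) (towerOn n (fun i => A i ω) c)}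
    set D₂ := {ω | ∃ m : ℕ, Straddles y (towerOn n (fun i => A i ω) c)
      (towerOn n (fun i => A i ω) (c + m))}
    have hD₁ : MeasurableSet[sigmaOf A (Set.Iio n)] D₁ :=
      measurableSet_straddles (m := sigmaOf A (Set.Iio n))
        (measurable_towerOn (m := sigmaOf A (Set.Iio n)) (fun i hi => measurable_sigmaOf hi) 0)
        (measurable_towerOn (m := sigmaOf A (Set.Iio n)) (fun i hi => measurable_sigmaOf hi) c) y
    have hD₂ : MeasurableSet[sigmaOf A (Set.Iio n)] D₂ :=
      measurableSet_exists_straddles (m := sigmaOf A (Set.Iio n))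
        (fun i hi => measurable_sigmaOf hi) y c
    have e₁ := measureReal_straddleSet_add_le hmeas hpos hindep hident (n := n) (N := N) (y := y)
      hK₁ hD₁ (by
        rintro ω hω hw ⟨m, hm⟩
        rw [towerOn_add, towerOn_add] at hm
        have hw' : ∀ j < N, A (j + n) ω ∈ K₁ j := fun j hj => by rw [add_comm]; exact hw j hj
        exact hm.widen (towerOn_monotoneOn_or_antitoneOn hω n) le_rfl
          ⟨towerOn_nonneg (fun i => (hω _).le) le_rfl N, h₁ _ (fun i => hω _) hw' _ le_rfl⟩
          ⟨towerOn_nonneg (fun i => (hω _).le) (Nat.cast_nonneg m) N,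
            h₁ _ (fun i => hω _) hw' _ (Nat.cast_nonneg m)⟩)
    have e₂ := measureReal_straddleSet_add_le hmeas hpos hindep hident (n := n) (N := N) (y := y)
      hK₂ hD₂ (by
        rintro ω hω hw ⟨m, hm⟩
        rw [towerOn_add, towerOn_add] at hm
        have hw' : ∀ j < N, A (j + n) ω ∈ K₂ j := fun j hj => by rw [add_comm]; exact hw j hj
        obtain ⟨k, hk⟩ := exists_nat_ge (max (towerOn N (fun i => A (i + n) ω) 0)
          (towerOn N (fun i => A (i + n) ω) m))
        refine ⟨k, hm.widen (towerOn_monotoneOn_or_antitoneOn hω n) hc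
          ⟨h₂ _ (fun i => hω _) hw' _ le_rfl, ?_⟩
          ⟨h₂ _ (fun i => hω _) hw' _ (Nat.cast_nonneg m), ?_⟩⟩
        · linarith [(le_max_left _ _).trans hk]
        · linarith [(le_max_right _ _).trans hk])
    rw [← hδ₁] at e₁
    rw [← hδ₂] at e₂
    have e₃ : P.real (straddleSet A n y) ≤
        P.real (straddleSet A n y \ D₁) + P.real (straddleSet A n y \ D₂) := by
      refine le_trans ?_ (measureReal_union_le _ _)
      refine ENNReal.toReal_mono (measure_ne_top _ _) (measure_mono_ae ?_)
      filter_upwards [hpos] with ω hω hmem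
      by_cases hd : ω ∈ D₁
      · refine Or.inr ⟨hmem, ?_⟩
        rintro ⟨m, hm⟩
        exact not_straddles_of_straddles (towerOn_monotoneOn_or_antitoneOn hω n) hc
          (by linarith [Nat.cast_nonneg (α := ℝ) m]) hd hm
      · exact Or.inl ⟨hmem, hd⟩
    have n₁ : 0 ≤ P.real (straddleSet A n y \ D₁) := measureReal_nonneg
    have n₂ : 0 ≤ P.real (straddleSet A n y \ D₂) := measureReal_nonneg
    have m₁ := mul_le_mul_of_nonneg_right (min_le_left δ₁ δ₂) n₁
    have m₂ := mul_le_mul_of_nonneg_right (min_le_right δ₁ δ₂) n₂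
    have m₃ := mul_le_mul_of_nonneg_left e₃ hδ0.le
    rw [← hδ] at m₁ m₂
    linarith
  have hδ1 : δ ≤ 1 := (min_le_left _ _).trans (Finset.prod_le_one (fun _ _ => measureReal_nonneg)
    fun _ _ => measureReal_le_one)
  have hpow : ∀ y k, P.real (straddleSet A (k * N) y) ≤ (1 - δ / 2) ^ k := by
    intro y k
    induction k with
    | zero => simp
    | succ k ih =>
      rw [Nat.succ_mul, pow_succ, mul_comm (_ ^ k)]
      exact (hcontr _ y).trans (mul_le_mul_of_nonneg_left ih
        (by linarith : (0 : ℝ) ≤ 1 - δ / 2))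
  have hnull : ∀ y, ∀ᵐ ω ∂P, ∃ n, ω ∉ straddleSet A n y := by
    intro y
    rw [ae_iff]
    have hle : ∀ k, P.real {ω | ¬ ∃ n, ω ∉ straddleSet A n y} ≤ (1 - δ / 2) ^ k := fun k =>
      (measureReal_mono fun ω hω => by
        by_contra hcon
        exact hω ⟨_, hcon⟩).trans (hpow y k)
    have hlim := tendsto_pow_atTop_nhds_zero_of_lt_one (r := 1 - δ / 2) (by linarith) (by linarith)
    have h0 : P.real {ω | ¬ ∃ n, ω ∉ straddleSet A n y} ≤ 0 := ge_of_tendsto' hlim hle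
    exact (measureReal_eq_zero_iff).mp (le_antisymm h0 measureReal_nonneg)
  have hall : ∀ᵐ ω ∂P, ∀ q : ℚ, ∃ n, ω ∉ straddleSet A n q := ae_all_iff.mpr fun q => hnull q
  filter_upwards [hall, hpos, hbdd] with ω hω hω0 hbd
  obtain ⟨M, hM⟩ := hbd
  -- A gap crossed infinitely often would contain a rational straddled at every level.
  refine tendsto_of_no_upcrossings dense_univ ?_
    (isBoundedUnder_of ⟨M, hM⟩)
    (isBoundedUnder_of ⟨0, fun n => towerOn_nonneg (fun i => (hω0 i).le) zero_le_one n⟩)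
  rintro p - q - hpq ⟨hp, hq⟩
  obtain ⟨r, hpr, hrq⟩ := exists_rat_btwn hpq
  obtain ⟨n, hn⟩ := hω r
  obtain ⟨k, hk, hkp⟩ := frequently_atTop.mp hp n
  obtain ⟨l, hl, hlq⟩ := frequently_atTop.mp hq n
  obtain ⟨k, rfl⟩ := Nat.exists_eq_add_of_le hk
  obtain ⟨l, rfl⟩ := Nat.exists_eq_add_of_le hl
  exact hn (mem_straddleSet_of_straddles hω0 zero_le_one zero_le_one
    (Or.inl ⟨hkp.trans hpr, hrq.trans hlq⟩))

/-- Convergence when entries below `1` and entries above `1` both occur. -/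
theorem ae_exists_tendsto_of_lt_one_of_one_lt (hmeas : ∀ n, Measurable (A n))
    (hpos : ∀ᵐ ω ∂P, ∀ n, 0 < A n ω)
    (hindep : iIndepFun A P) (hident : ∀ n, IdentDistrib (A n) (A 0) P P)
    (h₁ : P (A 0 ⁻¹' Set.Iio 1) ≠ 0) (h₂ : P (A 0 ⁻¹' Set.Ioi 1) ≠ 0) :
    ∀ᵐ ω ∂P, ∃ l, Tendsto (fun n => towerOn n (fun i => A i ω) 1) atTop (𝓝 l) := by
  refine ae_exists_tendsto_of_splitting hmeas hpos hindep hident (c := 1) zero_le_one (N := 1)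
    (K₁ := fun _ => Set.Iio 1) (K₂ := fun _ => Set.Ioi 1) (fun _ => measurableSet_Iio)
    (fun _ => measurableSet_Ioi) (fun _ => h₁) (fun _ => h₂) ?_ ?_ ?_
  · intro x hx hx1 t ht
    exact Real.rpow_le_one (hx 0).le (le_of_lt (hx1 0 one_pos)) ht
  · intro x hx hx1 t ht
    exact Real.one_le_rpow (le_of_lt (hx1 0 one_pos)) ht
  · have hex : ∀ᵐ ω ∂P, ∃ i, A i ω < 1 := by
      rw [ae_iff]
      set r := P.real (A 0 ⁻¹' Set.Ici 1) with hr
      have hr1 : r < 1 := by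
        have hc : A 0 ⁻¹' Set.Ici 1 = (A 0 ⁻¹' Set.Iio 1)ᶜ := by ext; simp
        rw [hr, hc, probReal_compl_eq_one_sub (hmeas 0 measurableSet_Iio)]
        have : 0 < P.real (A 0 ⁻¹' Set.Iio 1) := ENNReal.toReal_pos h₁ (measure_ne_top _ _)
        linarith
      have hle : ∀ n, P.real {ω | ¬ ∃ i, A i ω < 1} ≤ r ^ n := fun n => by
        have hw := measure_window hindep hident 0 n (K := fun _ => Set.Ici 1)
          fun _ => measurableSet_Ici
        rw [Finset.prod_const, Finset.card_range] at hw
        rw [hr, measureReal_def (s := A 0 ⁻¹' Set.Ici 1), ← ENNReal.toReal_pow, ← hw]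
        refine measureReal_mono (fun ω hω j _ => ?_) (measure_ne_top _ _)
        by_contra hcon
        exact hω ⟨_, not_le.mp hcon⟩
      have hlim := tendsto_pow_atTop_nhds_zero_of_lt_one measureReal_nonneg hr1
      exact (measureReal_eq_zero_iff).mp (le_antisymm (ge_of_tendsto' hlim hle) measureReal_nonneg)
    filter_upwards [hex, hpos] with ω ⟨i, hi⟩ hω
    set x := fun i => A i ω with hxdef
    have hnn : ∀ n, ∀ t ≥ 0, 0 ≤ towerOn n x t := fun n t ht =>
      towerOn_nonneg (fun j => (hω j).le) ht n
    -- Above the entry `x i < 1` the tower lies in `[0, 1]`, and a monotone or antitone map is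
    -- bounded there by its end values. The last sum covers the heights up to `i`.
    refine ⟨towerOn i x 0 + towerOn i x 1 +
      ∑ k ∈ Finset.range (i + 1), towerOn k x 1, fun n => ?_⟩
    have hsum : 0 ≤ ∑ k ∈ Finset.range (i + 1), towerOn k x 1 :=
      Finset.sum_nonneg fun k _ => hnn k 1 zero_le_one
    have a0 := hnn i 0 le_rfl
    have a1 := hnn i 1 zero_le_one
    rcases le_or_gt n i with hn | hn
    · have := Finset.single_le_sum (f := fun k => towerOn k x 1)
        (fun k _ => hnn k 1 zero_le_one) (Finset.mem_range.mpr (by omega : n < i + 1))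
      linarith
    · obtain ⟨k, rfl⟩ := Nat.exists_eq_add_of_le (Nat.succ_le_of_lt hn)
      rw [Nat.succ_eq_add_one, add_assoc, towerOn_add, add_comm 1 k]
      simp only [towerOn, zero_add]
      set u := towerOn k (fun j => x (j + 1 + i)) 1
      have hu : 0 ≤ u := towerOn_nonneg (fun j => (hω _).le) zero_le_one k
      have hv0 : 0 ≤ x i ^ u := Real.rpow_nonneg (hω i).le _
      have hv1 : x i ^ u ≤ 1 := Real.rpow_le_one (hω i).le hi.le hu
      rcases towerOn_monotoneOn_or_antitoneOn hω i with hm | hm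
      · have := hm hv0 (zero_le_one (α := ℝ)) hv1
        change towerOn i x (x i ^ u) ≤ towerOn i x 1 at this
        linarith
      · have := hm (le_refl (0 : ℝ)) hv0 hv0
        change towerOn i x (x i ^ u) ≤ towerOn i x 0 at this
        linarith

end Probability

/-! ### The threshold function -/

/-- With `u = exp (-s)` and `β = -log b`, the equation `p ^ b ^ u = u` reads `log (-log p) = log s +
β * exp (-s)`. The following lemmas bound this function of `s` under `s ≤ β * exp (-s)`, which is
the condition `b ^ u ≤ u`. -/
theorem hasDerivAt_log_add_mul_exp_neg (β : ℝ) {s : ℝ} (hs : 0 < s) :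
    HasDerivAt (fun s => Real.log s + β * Real.exp (-s)) (s⁻¹ - β * Real.exp (-s)) s := by
  have h := (Real.hasDerivAt_log hs.ne').add (((hasDerivAt_neg s).exp).const_mul β)
  refine h.congr_deriv ?_
  ring

theorem log_add_mul_exp_neg_le {β s t : ℝ} (hs : 0 < s) (hst : s ≤ t)
    (h : ∀ r ∈ Set.Icc s t, β * Real.exp (-r) * r ≤ 1) :
    Real.log s + β * Real.exp (-s) ≤ Real.log t + β * Real.exp (-t) := by
  have hd : ∀ r ∈ Set.Icc s t, HasDerivAt (fun s => Real.log s + β * Real.exp (-s))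
      (r⁻¹ - β * Real.exp (-r)) r := fun r hr =>
    hasDerivAt_log_add_mul_exp_neg β (hs.trans_le hr.1)
  refine monotoneOn_of_hasDerivWithinAt_nonneg (convex_Icc s t)
    (fun r hr => (hd r hr).continuousAt.continuousWithinAt)
    (fun r hr => (hd r (interior_subset hr)).hasDerivWithinAt) (fun r hr => ?_)
    (Set.left_mem_Icc.mpr hst) (Set.right_mem_Icc.mpr hst) hst
  have hr' := interior_subset hr
  have hr0 : 0 < r := hs.trans_le hr'.1
  rw [sub_nonneg, inv_eq_one_div, le_div_iff₀ hr0]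
  exact h r hr'

theorem le_log_add_mul_exp_neg {β s t : ℝ} (hs : 0 < s) (hst : s ≤ t)
    (h : ∀ r ∈ Set.Icc s t, 1 ≤ β * Real.exp (-r) * r) :
    Real.log t + β * Real.exp (-t) ≤ Real.log s + β * Real.exp (-s) := by
  have hd : ∀ r ∈ Set.Icc s t, HasDerivAt (fun s => Real.log s + β * Real.exp (-s))
      (r⁻¹ - β * Real.exp (-r)) r := fun r hr =>
    hasDerivAt_log_add_mul_exp_neg β (hs.trans_le hr.1)
  refine antitoneOn_of_hasDerivWithinAt_nonpos (convex_Icc s t)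
    (fun r hr => (hd r hr).continuousAt.continuousWithinAt)
    (fun r hr => (hd r (interior_subset hr)).hasDerivWithinAt) (fun r hr => ?_)
    (Set.left_mem_Icc.mpr hst) (Set.right_mem_Icc.mpr hst) hst
  have hr' := interior_subset hr
  have hr0 : 0 < r := hs.trans_le hr'.1
  rw [sub_nonpos, inv_eq_one_div, div_le_iff₀ hr0]
  exact h r hr'

theorem exp_neg_mul_self_le {r w : ℝ} (hrw : r ≤ w) (hw : w ≤ 1) (hw0 : 0 ≤ w) :
    Real.exp (-r) * r ≤ Real.exp (-w) * w := by
  have h : r ≤ Real.exp (r - w) * w := by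
    have := Real.add_one_le_exp (r - w)
    nlinarith
  calc Real.exp (-r) * r ≤ Real.exp (-r) * (Real.exp (r - w) * w) := by gcongr
    _ = Real.exp (-w) * w := by rw [← mul_assoc, ← Real.exp_add]; ring_nf

/-- For `β ≤ e` the function is increasing, since `β * r * exp (-r) ≤ β / e ≤ 1`. The constraint
means `s ≤ W(β)`, and at `w = W(β)` the value is `log w + w = log β`. -/
theorem log_add_mul_exp_neg_le_log {β s : ℝ} (hs : 0 < s) (hβ : β ≤ Real.exp 1)
    (h : s ≤ β * Real.exp (-s)) : Real.log s + β * Real.exp (-s) ≤ Real.log β := by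
  have hβ0 : 0 < β := by
    by_contra hcon
    have := mul_nonpos_of_nonpos_of_nonneg (not_lt.mp hcon) (Real.exp_pos (-s)).le
    linarith
  obtain ⟨hw1, hw⟩ := lambertW_spec (z := β) (by linarith [Real.exp_pos (-1)])
  set w := lambertW β
  have hw0 : 0 < w := by
    by_contra hcon
    have := mul_nonpos_of_nonpos_of_nonneg (not_lt.mp hcon) (Real.exp_pos w).le
    linarith
  have hwβ : w = β * Real.exp (-w) := by
    rw [← hw, mul_assoc, ← Real.exp_add]; simp
  have hsw : s ≤ w := by
    by_contra hcon
    have h1 : Real.exp (-s) ≤ Real.exp (-w) := Real.exp_le_exp.mpr (by linarith)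
    have := mul_le_mul_of_nonneg_left h1 hβ0.le
    linarith
  refine (log_add_mul_exp_neg_le hs hsw fun r hr => ?_).trans ?_
  · have h1 : Real.exp (-r) * r ≤ Real.exp (-1) := by
      have := Real.add_one_le_exp (r - 1)
      calc Real.exp (-r) * r ≤ Real.exp (-r) * Real.exp (r - 1) := by gcongr; linarith
        _ = Real.exp (-1) := by rw [← Real.exp_add]; ring_nf
    have h2 : 0 ≤ Real.exp (-r) * r := mul_nonneg (Real.exp_pos _).le (hs.le.trans hr.1)
    calc β * Real.exp (-r) * r = β * (Real.exp (-r) * r) := by ring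
      _ ≤ Real.exp 1 * Real.exp (-1) := mul_le_mul hβ h1 h2 (Real.exp_pos 1).le
      _ = 1 := by rw [← Real.exp_add]; simp
  · rw [← hwβ]
    conv_rhs => rw [← hw]
    rw [Real.log_mul hw0.ne' (Real.exp_ne_zero w), Real.log_exp]

/-- Here `w` is the critical point in `(0, 1]`. The function increases up to `w` and then decreases
as far as the constraint lets `s` go. -/
theorem log_add_mul_exp_neg_le_log_add_inv {β s w : ℝ} (hs : 0 < s) (hw0 : 0 < w) (hw1 : w ≤ 1)
    (hw : β * Real.exp (-w) * w = 1) (hβ : 0 ≤ β)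
    (h : s ≤ β * Real.exp (-s)) : Real.log s + β * Real.exp (-s) ≤ Real.log w + w⁻¹ := by
  rw [← eq_inv_of_mul_eq_one_left hw]
  rcases le_total s w with hsw | hsw
  · refine log_add_mul_exp_neg_le hs hsw fun r hr => ?_
    rw [← hw, mul_assoc, mul_assoc]
    exact mul_le_mul_of_nonneg_left (exp_neg_mul_self_le hr.2 hw1 hw0.le) hβ
  · refine le_log_add_mul_exp_neg hw0 hsw fun r hr => ?_
    rcases le_total r 1 with hr1 | hr1
    · rw [← hw, mul_assoc, mul_assoc]
      exact mul_le_mul_of_nonneg_left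
        (exp_neg_mul_self_le hr.1 hr1 (hw0.le.trans hr.1)) hβ
    -- Past `1` the derivative stays nonpositive because `1 ≤ r ≤ s ≤ β * exp (-s) ≤ β * exp (-r)`.
    · have h1 : Real.exp (-s) ≤ Real.exp (-r) := Real.exp_le_exp.mpr (by linarith [hr.2])
      have h2 := mul_le_mul_of_nonneg_left h1 hβ
      have h3 : 1 ≤ β * Real.exp (-r) := by linarith [hr.2]
      nlinarith

/-- Taking `w = -W(1 / log b)` removes the Lambert function: `w` is the critical point above, and
`log (-log (G b)) = log w + w⁻¹` is the critical value. -/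
theorem exists_G_eq {b : ℝ} (hb0 : 0 < b) (hb : b < Real.exp (-Real.exp 1)) :
    ∃ w, 0 < w ∧ w < 1 ∧ -Real.log b * Real.exp (-w) * w = 1 ∧
      G b = Real.exp (-(w * Real.exp w⁻¹)) := by
  have hlog : Real.log b < -Real.exp 1 := (Real.log_lt_iff_lt_exp hb0).mpr hb
  have he : 0 < Real.exp 1 := Real.exp_pos 1
  have hge : -Real.exp (-1) ≤ 1 / Real.log b := by
    rw [Real.exp_neg, ← one_div, ← one_div_neg_eq_neg_one_div]
    exact one_div_le_one_div_of_neg_of_le (by linarith) hlog.le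
  obtain ⟨hW1, hW⟩ := lambertW_spec hge
  set W := lambertW (1 / Real.log b) with hWdef
  have hmul : Real.log b * (W * Real.exp W) = 1 := by
    rw [hW]; exact mul_one_div_cancel (by linarith)
  refine ⟨-W, ?_, ?_, ?_, ?_⟩
  · by_contra hcon
    have := mul_nonneg (by linarith : 0 ≤ W) (Real.exp_pos W).le
    nlinarith
  · rcases hW1.lt_or_eq with h | h
    · linarith
    · rw [← h] at hmul
      have h1 : Real.exp 1 * Real.exp (-1) = 1 := by rw [← Real.exp_add]; simp
      have h2 : 0 < Real.exp (-1) := Real.exp_pos _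
      nlinarith
  · rw [neg_neg]; linarith
  · rw [G, if_neg (not_le.mpr hb), if_neg hb0.ne', ← hWdef]
    congr 1
    rw [inv_neg, one_div]
    ring

theorem G_pos {b : ℝ} (hb0 : 0 < b) : 0 < G b := by
  unfold G
  split_ifs with h1 h2
  · exact hb0
  · exact absurd h2 hb0.ne'
  · exact Real.exp_pos _

/-- This is the optimality of `G`: among `u` with `b ^ u ≤ u`, the quotient `-log u / b ^ u` never
exceeds `-log (G b)`. The endpoint `u = 1` is separate because there `s = 0`. -/
theorem log_G_mul_rpow_le {b u : ℝ} (hb0 : 0 < b) (hb1 : b ≤ 1) (hu0 : 0 < u) (hu1 : u ≤ 1)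
    (h : b ^ u ≤ u) : Real.log (G b) * b ^ u ≤ Real.log u := by
  rcases hu1.eq_or_lt with rfl | hu1
  · rw [Real.log_one]
    exact mul_nonpos_of_nonpos_of_nonneg
      (Real.log_nonpos (G_mem ⟨hb0.le, hb1⟩).1 (G_mem ⟨hb0.le, hb1⟩).2) (Real.rpow_nonneg hb0.le _)
  set s := -Real.log u with hs
  set β := -Real.log b with hβ
  have hs0 : 0 < s := neg_pos.mpr (Real.log_neg hu0 hu1)
  have hus : u = Real.exp (-s) := by rw [hs, neg_neg, Real.exp_log hu0]
  have hbu : b ^ u = Real.exp (-(β * Real.exp (-s))) := by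
    rw [Real.rpow_def_of_pos hb0, ← hus, hβ]; ring_nf
  have hβ0 : 0 ≤ β := neg_nonneg.mpr (Real.log_nonpos hb0.le hb1)
  have hle : s ≤ β * Real.exp (-s) := by
    rw [hbu, hus, Real.exp_le_exp] at h
    linarith
  have main : ∀ γ, 0 < γ → Real.log s + β * Real.exp (-s) ≤ Real.log γ →
      -γ * b ^ u ≤ Real.log u := by
    intro γ hγ hψ
    have h1 : s * Real.exp (β * Real.exp (-s)) ≤ γ := by
      rw [← Real.exp_log hγ, ← Real.exp_log hs0, Real.exp_log hs0]
      conv_lhs => rw [← Real.exp_log hs0, ← Real.exp_add, Real.exp_log hs0]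
      exact Real.exp_le_exp.mpr hψ
    have h2 : s ≤ γ * b ^ u := by
      rw [hbu, Real.exp_neg, ← div_eq_mul_inv, le_div_iff₀ (Real.exp_pos _)]
      exact h1
    linarith
  rcases le_or_gt (Real.exp (-Real.exp 1)) b with hbe | hbe
  · have hG : G b = b := by rw [G, if_pos hbe]
    have hβe : β ≤ Real.exp 1 := by
      have := (Real.le_log_iff_exp_le hb0).mpr hbe
      linarith
    have hβpos : 0 < β := by
      rcases hβ0.eq_or_lt with h0 | h0
      · rw [← h0, zero_mul] at hle; linarith
      · exact h0
    have := main β hβpos (log_add_mul_exp_neg_le_log hs0 hβe hle)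
    rwa [hG, ← neg_neg (Real.log b), ← hβ]
  · obtain ⟨w, hw0, hw1, hw, hG⟩ := exists_G_eq hb0 hbe
    rw [hG, Real.log_exp]
    refine main _ (mul_pos hw0 (Real.exp_pos _)) ?_
    rw [Real.log_mul hw0.ne' (Real.exp_ne_zero _), Real.log_exp]
    exact log_add_mul_exp_neg_le_log_add_inv hs0 hw0 hw1.le hw hβ0 hle

/-- The two-cycle separating the even from the odd towers. -/
theorem exists_two_cycle {b : ℝ} (hb0 : 0 < b) (hb : b < Real.exp (-Real.exp 1)) :
    ∃ u v, 0 < v ∧ v < u ∧ u ≤ 1 ∧ b ^ u = v ∧ G b ^ v = u := by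
  obtain ⟨w, hw0, hw1, hw, hG⟩ := exists_G_eq hb0 hb
  -- From `-log b * exp (-w) = w⁻¹` one gets `b ^ u = exp (-w⁻¹)`; the exponentials in `(G b) ^ v`
  -- cancel to `exp (-w)`.
  refine ⟨Real.exp (-w), Real.exp (-w⁻¹), Real.exp_pos _, ?_, ?_, ?_, ?_⟩
  · rw [Real.exp_lt_exp, neg_lt_neg_iff]
    exact hw1.trans (one_lt_inv₀ hw0 |>.mpr hw1)
  · exact Real.exp_le_one_iff.mpr (by linarith)
  · rw [Real.rpow_def_of_pos hb0, ← eq_inv_of_mul_eq_one_left hw]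
    ring_nf
  · rw [hG, ← Real.exp_mul, neg_mul, mul_assoc, ← Real.exp_add, add_neg_cancel, Real.exp_zero,
      mul_one]

/-! ### Entries at most one -/

theorem towerOn_even_odd {x : ℕ → ℝ} (hx : ∀ i, x i ∈ Set.Ioc 0 1) (n : ℕ) :
    MonotoneOn (towerOn (2 * n) x) (Set.Ici 0) ∧
      AntitoneOn (towerOn (2 * n + 1) x) (Set.Ici 0) := by
  have hodd : ∀ m, ∀ x : ℕ → ℝ, (∀ i, x i ∈ Set.Ioc 0 1) →
      (MonotoneOn (towerOn m fun i => x (i + 1)) (Set.Ici 0) →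
        AntitoneOn (towerOn (m + 1) x) (Set.Ici 0)) ∧
      (AntitoneOn (towerOn m fun i => x (i + 1)) (Set.Ici 0) →
        MonotoneOn (towerOn (m + 1) x) (Set.Ici 0)) := fun m x hx =>
    ⟨fun h s hs t ht hst =>
      Real.rpow_le_rpow_of_exponent_ge (hx 0).1 (hx 0).2 (h hs ht hst),
     fun h s hs t ht hst =>
      Real.rpow_le_rpow_of_exponent_ge (hx 0).1 (hx 0).2 (h hs ht hst)⟩
  induction n generalizing x with
  | zero =>
    have h0 : ∀ x : ℕ → ℝ, MonotoneOn (towerOn 0 x) (Set.Ici 0) := fun x _ _ _ _ h => h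
    exact ⟨h0 x, (hodd 0 x hx).1 (h0 _)⟩
  | succ n ih =>
    have h1 := ih fun i => hx (i + 1)
    have h3 := (hodd _ _ fun i => hx (i + 1)).2 ((hodd _ _ fun i => hx (i + 1 + 1)).1
      (ih fun i => hx (i + 1 + 1 + 1)).1)
    exact ⟨(hodd _ x hx).2 h1.2, (hodd _ x hx).1 h3⟩

theorem towerOn_mem_Icc {x : ℕ → ℝ} (hx : ∀ i, x i ∈ Set.Ioc 0 1) {t : ℝ}
    (ht : t ∈ Set.Icc (0 : ℝ) 1) (n : ℕ) : towerOn n x t ∈ Set.Icc (0 : ℝ) 1 := by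
  refine ⟨towerOn_nonneg (fun i => (hx i).1.le) ht.1 n, ?_⟩
  cases n with
  | zero => exact ht.2
  | succ n =>
    exact Real.rpow_le_one (hx 0).1.le (hx 0).2 (towerOn_nonneg (fun i => (hx _).1.le) ht.1 n)

/-- With entries in `[G b, b]`, even and odd towers converge to distinct limits. -/
theorem exists_tendsto_even_odd {b : ℝ} (hb0 : 0 < b) (hb : b < Real.exp (-Real.exp 1))
    {x : ℕ → ℝ} (hx : ∀ i, x i ∈ Set.Icc (G b) b) :
    ∃ l₀ l₁ : ℝ, Tendsto (fun n => towerOn (2 * n) x 1) atTop (𝓝 l₀) ∧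
      Tendsto (fun n => towerOn (2 * n + 1) x 1) atTop (𝓝 l₁) ∧ l₀ ≠ l₁ := by
  obtain ⟨u, v, hv0, hvu, hu1, hbu, hGv⟩ := exists_two_cycle hb0 hb
  have hG0 : 0 < G b := G_pos hb0
  have hb1 : b ≤ 1 := hb.le.trans (Real.exp_le_one_iff.mpr (by linarith [Real.exp_pos 1]))
  have hIoc : ∀ y : ℕ → ℝ, (∀ i, y i ∈ Set.Icc (G b) b) → ∀ i, y i ∈ Set.Ioc (0 : ℝ) 1 :=
    fun y hy i => ⟨hG0.trans_le (hy i).1, (hy i).2.trans hb1⟩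
  have hstep : ∀ n, ∀ y : ℕ → ℝ, (∀ i, y i ∈ Set.Icc (G b) b) →
      u ≤ towerOn n (fun i => y (i + 1)) 1 → towerOn (n + 1) y 1 ≤ v := by
    intro n y hy h
    rw [← hbu]
    exact (Real.rpow_le_rpow_of_exponent_ge (hIoc y hy 0).1 (hIoc y hy 0).2 h).trans
      (Real.rpow_le_rpow (hIoc y hy 0).1.le (hy 0).2 (hv0.trans hvu).le)
  have hsep : ∀ n, ∀ y : ℕ → ℝ, (∀ i, y i ∈ Set.Icc (G b) b) →
      u ≤ towerOn (2 * n) y 1 := by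
    intro n
    induction n with
    | zero => intro y _; simpa [towerOn] using hu1
    | succ n ih =>
      intro y hy
      have h1 := hstep _ (fun i => y (i + 1)) (fun i => hy _) (ih _ fun i => hy (i + 1 + 1))
      rw [← hGv]
      exact (Real.rpow_le_rpow hG0.le (hy 0).1 hv0.le).trans
        (Real.rpow_le_rpow_of_exponent_ge (hIoc y hy 0).1 (hIoc y hy 0).2 h1)
  have hmem : ∀ n, ∀ y : ℕ → ℝ, (∀ i, y i ∈ Set.Icc (G b) b) →
      towerOn n y 1 ∈ Set.Icc (0 : ℝ) 1 := fun n y hy =>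
    towerOn_mem_Icc (hIoc y hy) ⟨zero_le_one, le_rfl⟩ n
  -- Two more entries replace the top `1` by a number in `[0, 1]`; even compositions preserve this
  -- order and odd ones reverse it.
  have hanti : Antitone fun n => towerOn (2 * n) x 1 := by
    refine antitone_nat_of_succ_le fun n => ?_
    rw [Nat.mul_succ, towerOn_add]
    have := hmem 2 (fun i => x (i + 2 * n)) fun i => hx _
    exact (towerOn_even_odd (hIoc x hx) n).1 this.1 (zero_le_one (α := ℝ)) this.2
  have hmono : Monotone fun n => towerOn (2 * n + 1) x 1 := by
    refine monotone_nat_of_le_succ fun n => ?_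
    change towerOn (2 * n + 1) x 1 ≤ towerOn (2 * (n + 1) + 1) x 1
    rw [show 2 * (n + 1) + 1 = (2 * n + 1) + 2 by ring, towerOn_add (2 * n + 1) 2]
    have := hmem 2 (fun i => x (i + (2 * n + 1))) fun i => hx _
    exact (towerOn_even_odd (hIoc x hx) n).2 this.1 (zero_le_one (α := ℝ)) this.2
  have h0 := tendsto_atTop_ciInf hanti ⟨0, by rintro _ ⟨n, rfl⟩; exact (hmem _ x hx).1⟩
  have h1 := tendsto_atTop_ciSup hmono ⟨1, by rintro _ ⟨n, rfl⟩; exact (hmem _ x hx).2⟩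
  refine ⟨_, _, h0, h1, ?_⟩
  have e0 := ge_of_tendsto' h0 fun n => hsep n x hx
  have e1 := le_of_tendsto' h1 fun n => hstep _ x hx (hsep n _ fun i => hx (i + 1))
  exact (lt_of_le_of_lt e1 (hvu.trans_le e0)).ne'

/-! ### Alternating patterns -/

/-- The extreme case has every even entry equal to `p` and every odd entry equal to `q`. One small
entry beyond the `n` pairs brings an arbitrary top below `1`, where the iteration starts. -/
theorem towerOn_le_iterate {p q : ℝ} (hp : p ≤ 1) (hq : 0 < q) {n m : ℕ}
    (hm : 2 * n + 1 ≤ m) {x : ℕ → ℝ} (hx : ∀ i, 0 < x i) (he : ∀ j < m, Even j → x j ≤ p)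
    (ho : ∀ j < m, ¬ Even j → x j ∈ Set.Icc q 1) {t : ℝ} (ht : 0 ≤ t) :
    towerOn m x t ≤ (fun t : ℝ => p ^ q ^ t)^[n] 1 := by
  induction n generalizing m x with
  | zero =>
    obtain ⟨k, rfl⟩ := Nat.exists_eq_add_of_le' hm
    exact Real.rpow_le_one (hx 0).le ((he 0 (by omega) (by decide)).trans hp)
      (towerOn_nonneg (fun i => (hx _).le) ht _)
  | succ n ih =>
    obtain ⟨k, rfl⟩ := Nat.exists_eq_add_of_le' (show 2 ≤ m by omega)
    have h := ih (m := k) (by omega) (x := fun i => x (i + 1 + 1)) (fun i => hx _)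
      (fun j hj hj' => he _ (by omega) (by simpa [add_assoc, Nat.even_add] using hj'))
      (fun j hj hj' => ho _ (by omega) (by simpa [add_assoc, Nat.even_add] using hj'))
    have h0 : 0 ≤ towerOn k (fun i => x (i + 1 + 1)) t :=
      towerOn_nonneg (fun i => (hx _).le) ht _
    have hx0 := he 0 (by omega) (by decide)
    have hx1 := ho 1 (by omega) (by decide)
    rw [Function.iterate_succ_apply']
    set z := (fun t : ℝ => p ^ q ^ t)^[n] 1
    have h2 : q ^ z ≤ x 1 ^ towerOn k (fun i => x (i + 1 + 1)) t :=
      (Real.rpow_le_rpow hq.le hx1.1 (h0.trans h)).trans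
        (Real.rpow_le_rpow_of_exponent_ge (hx 1) hx1.2 h)
    exact (Real.rpow_le_rpow_of_exponent_ge (hx 0) (hx0.trans hp) h2).trans
      (Real.rpow_le_rpow (hx 0).le hx0 (Real.rpow_nonneg hq.le _))

/-- Otherwise the decreasing iterates converge to a fixed point `u` with `b ^ u ≤ u`, and
`log_G_mul_rpow_le` gives `G b ≤ p`. -/
theorem exists_iterate_lt {b p : ℝ} (hb0 : 0 < b) (hb1 : b ≤ 1) (hp0 : 0 < p) (hp : p < G b) :
    ∃ n, (fun t : ℝ => p ^ b ^ t)^[n] 1 < b ^ ((fun t : ℝ => p ^ b ^ t)^[n] 1) := by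
  by_contra! hcon
  set f : ℝ → ℝ := fun t => p ^ b ^ t with hf
  have hp1 : p ≤ 1 := hp.le.trans (G_mem ⟨hb0.le, hb1⟩).2
  have hfm : Monotone f := fun s t hst =>
    Real.rpow_le_rpow_of_exponent_ge hp0 hp1 (Real.rpow_le_rpow_of_exponent_ge hb0 hb1 hst)
  have hf1 : f 1 ≤ 1 := Real.rpow_le_one hp0.le hp1 (Real.rpow_nonneg hb0.le _)
  have hfc : Continuous f :=
    (Real.continuous_const_rpow hp0.ne').comp (Real.continuous_const_rpow hb0.ne')
  have hanti := hfm.antitone_iterate_of_map_le hf1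
  have hnn : ∀ n, 0 ≤ f^[n] 1 := fun n => by
    cases n with
    | zero => exact zero_le_one
    | succ n => rw [Function.iterate_succ_apply']; exact Real.rpow_nonneg hp0.le _
  have hlim := tendsto_atTop_ciInf (f := fun n => f^[n] 1) (fun m n h => hanti h)
    ⟨0, by rintro _ ⟨n, rfl⟩; exact hnn n⟩
  set u := ⨅ n, f^[n] 1
  have hfix : f u = u := isFixedPt_of_tendsto_iterate hlim hfc.continuousAt
  have hu0 : 0 < u := by rw [← hfix]; exact Real.rpow_pos_of_pos hp0 _
  have hu1 : u ≤ 1 := le_of_tendsto' hlim fun n => hanti (Nat.zero_le n)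
  have hbu : b ^ u ≤ u :=
    le_of_tendsto_of_tendsto' (((Real.continuous_const_rpow hb0.ne').tendsto u).comp hlim) hlim hcon
  have h := log_G_mul_rpow_le hb0 hb1 hu0 hu1 hbu
  have hlogu : Real.log u = Real.log p * b ^ u := by
    conv_lhs => rw [← hfix]
    rw [hf, Real.log_rpow hp0, mul_comm]
  rw [hlogu] at h
  have h1 := le_of_mul_le_mul_right h (Real.rpow_pos_of_pos hb0 u)
  exact absurd (Real.log_lt_log hp0 hp) (not_lt.mpr h1)

/-- Only the intervals above some `q < b` are known to carry mass, so `b` is lowered to such a `q`;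
the inequality is strict and continuous in `q`. -/
theorem exists_iterate_lt_of_lt {b p : ℝ} (hb0 : 0 < b) (hb1 : b ≤ 1) (hp0 : 0 < p)
    (hp : p < G b) :
    ∃ n, ∃ q, 0 < q ∧ q < b ∧
      (fun t : ℝ => p ^ q ^ t)^[n] 1 < q ^ ((fun t : ℝ => p ^ q ^ t)^[n] 1) := by
  obtain ⟨n, hn⟩ := exists_iterate_lt hb0 hb1 hp0 hp
  have hc : ∀ n, ContinuousAt (fun q : ℝ => (fun t : ℝ => p ^ q ^ t)^[n] 1) b := by
    intro n
    induction n with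
    | zero => exact continuousAt_const
    | succ n ih =>
      simp only [Function.iterate_succ_apply']
      exact continuousAt_const.rpow (continuousAt_id.rpow ih (Or.inl hb0.ne')) (Or.inl hp0.ne')
  have hev := (hc n).eventually_lt (continuousAt_id.rpow (hc n) (Or.inl hb0.ne')) hn
  have h3 : ∀ᶠ q in 𝓝[<] b, 0 < q := eventually_nhdsWithin_of_eventually_nhds (lt_mem_nhds hb0)
  obtain ⟨q, h1, h2, h3⟩ := ((eventually_nhdsWithin_of_eventually_nhds hev).and
    (h3.and self_mem_nhdsWithin)).exists
  exact ⟨n, q, h2, h3, h1⟩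

/-- Convergence for entries at most `b ≤ 1` that fall below some `p < G b`. -/
theorem ae_exists_tendsto_of_lt_G {Ω : Type*} [MeasurableSpace Ω] {P : Measure Ω}
    [IsProbabilityMeasure P] {A : ℕ → Ω → ℝ} (hmeas : ∀ n, Measurable (A n))
    (hpos : ∀ᵐ ω ∂P, ∀ n, 0 < A n ω)
    (hindep : iIndepFun A P) (hident : ∀ n, IdentDistrib (A n) (A 0) P P)
    {b p : ℝ} (hb0 : 0 < b) (hb1 : b ≤ 1) (hle : ∀ᵐ ω ∂P, ∀ n, A n ω ≤ b)
    (hb : ∀ q < b, P (A 0 ⁻¹' Set.Ioi q) ≠ 0)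
    (hp : p < G b) (hPp : P (A 0 ⁻¹' Set.Iio p) ≠ 0) :
    ∀ᵐ ω ∂P, ∃ l, Tendsto (fun n => towerOn n (fun i => A i ω) 1) atTop (𝓝 l) := by
  have hp0 : 0 < p := by
    by_contra hcon
    refine hPp (measure_mono_null ?_ (ae_iff.mp hpos))
    intro ω hω h
    have h1 : A 0 ω < p := hω
    linarith [h 0, not_lt.mp hcon]
  have hp1 : p ≤ 1 := hp.le.trans (G_mem ⟨hb0.le, hb1⟩).2
  obtain ⟨n, q, hq0, hqb, hn⟩ := exists_iterate_lt_of_lt hb0 hb1 hp0 hp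
  set z := (fun t : ℝ => p ^ q ^ t)^[n] 1 with hz
  have hz0 : 0 ≤ z := by
    rw [hz]
    cases n with
    | zero => exact zero_le_one
    | succ n => rw [Function.iterate_succ_apply']; exact Real.rpow_nonneg hp0.le _
  have hPq : P (A 0 ⁻¹' Set.Ioc q 1) ≠ 0 := by
    intro h0
    refine hb q hqb (measure_mono_null (t := A 0 ⁻¹' Set.Ioc q 1 ∪ {ω | ¬ ∀ n, A n ω ≤ b}) ?_
      (measure_union_null h0 (ae_iff.mp hle)))
    intro ω hω
    by_cases h : ∀ n, A n ω ≤ b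
    · exact Or.inl ⟨hω, (h 0).trans hb1⟩
    · exact Or.inr h
  -- A pattern starting with a small entry gives a tower at most `z`. One large entry in front of
  -- such a pattern gives at least `q ^ z > z`, hence the length `(2 * n + 1) + 1`.
  refine ae_exists_tendsto_of_splitting hmeas hpos hindep hident (c := z) hz0 (N := 2 * n + 2)
    (K₁ := fun j => if Even j then Set.Iio p else Set.Ioc q 1)
    (K₂ := fun j => if Even j then Set.Ioc q 1 else Set.Iio p)
    (fun j => by split_ifs; exacts [measurableSet_Iio, measurableSet_Ioc])
    (fun j => by split_ifs; exacts [measurableSet_Ioc, measurableSet_Iio])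
    (fun j => by split_ifs; exacts [hPp, hPq]) (fun j => by split_ifs; exacts [hPq, hPp]) ?_ ?_ ?_
  · intro x hx hK t ht
    refine towerOn_le_iterate hp1 hq0 (by omega) hx (fun j hj hj' => ?_) (fun j hj hj' => ?_) ht
    · have := hK j hj
      rw [if_pos hj'] at this
      exact le_of_lt this
    · have := hK j hj
      rw [if_neg hj'] at this
      exact Set.Ioc_subset_Icc_self this
  · intro x hx hK t ht
    have h0 := hK 0 (by omega)
    rw [if_pos (by decide)] at h0
    have h := towerOn_le_iterate (n := n) (m := 2 * n + 1) hp1 hq0 le_rfl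
      (x := fun i => x (i + 1)) (fun i => hx _)
      (fun j hj hj' => by
        have := hK (j + 1) (by omega)
        rw [if_neg (by simpa [Nat.even_add_one] using hj')] at this
        exact le_of_lt this)
      (fun j hj hj' => by
        have := hK (j + 1) (by omega)
        rw [if_pos (by simpa [Nat.even_add_one] using hj')] at this
        exact Set.Ioc_subset_Icc_self this) ht
    exact hn.le.trans ((Real.rpow_le_rpow hq0.le h0.1.le hz0).trans
      (Real.rpow_le_rpow_of_exponent_ge (hx 0) h0.2 h))
  · filter_upwards [hpos, hle] with ω hω hωb
    exact ⟨1, fun n => (towerOn_mem_Icc (fun i => ⟨hω i, (hωb i).trans hb1⟩)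
      ⟨zero_le_one, le_rfl⟩ n).2⟩

/-! ### Entries at least one -/

/-- The tail-sum formula: a positive integer or infinite time is the number of `n` that it strictly
exceeds. -/
theorem firstSmall_eq_tsum (x : ℕ → ℝ) :
    firstSmall x = ∑' n, {n | ∀ k < n, x k ∈ Set.Ioi
      (Real.exp (1 / star (Real.exp 1) (k + 1)))}.indicator (1 : ℕ → ENNReal) n := by
  classical
  by_cases h : ∃ n, x n ≤ Real.exp (1 / star (Real.exp 1) (n + 1))
  · have hfind : firstSmall x = ((Nat.find h + 1 : ℕ) : ENNReal) := by
      refine le_antisymm (sInf_le ⟨_, rfl, Nat.find_spec h⟩) (le_sInf ?_)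
      rintro _ ⟨n, rfl, hn⟩
      exact_mod_cast Nat.succ_le_succ (Nat.find_min' h hn)
    rw [hfind, tsum_eq_sum (s := Finset.range (Nat.find h + 1))]
    · rw [Finset.sum_congr rfl (g := fun _ => 1), Finset.sum_const, Finset.card_range,
        nsmul_eq_mul, mul_one]
      intro n hn
      refine Set.indicator_of_mem (fun k hk => ?_) _
      rw [Finset.mem_range] at hn
      exact not_le.mp (Nat.find_min h (by omega))
    · intro n hn
      refine Set.indicator_of_notMem (fun hmem => ?_) _
      rw [Finset.mem_range] at hn
      exact absurd (Nat.find_spec h) (not_le.mpr (hmem _ (by omega)))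
  · push Not at h
    have h1 : firstSmall x = ⊤ := by
      rw [firstSmall, sInf_eq_top]
      rintro _ ⟨n, rfl, hn⟩
      exact absurd hn (not_le.mpr (h n))
    have h2 : {n | ∀ k < n, x k ∈ Set.Ioi
        (Real.exp (1 / star (Real.exp 1) (k + 1)))} = Set.univ :=
      Set.eq_univ_of_forall fun n k _ => h k
    rw [h1, h2, Set.indicator_univ]
    simp

variable {Ω : Type*} [MeasurableSpace Ω] {P : Measure Ω} {A : ℕ → Ω → ℝ}

/-- The probability that an entry exceeds the threshold `exp (1 / (e ⋆ (k + 1)))`. -/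
noncomputable def tailProb (P : Measure Ω) (A : ℕ → Ω → ℝ) (k : ℕ) : ENNReal :=
  P (A 0 ⁻¹' Set.Ioi (Real.exp (1 / star (Real.exp 1) (k + 1))))

theorem lintegral_firstSmall (hmeas : ∀ n, Measurable (A n)) (hindep : iIndepFun A P)
    (hident : ∀ n, IdentDistrib (A n) (A 0) P P) :
    ∫⁻ ω, firstSmall (fun i => A i ω) ∂P =
      ∑' n, ∏ k ∈ Finset.range n, tailProb P A k := by
  have hset : ∀ n, MeasurableSet {ω | ∀ k < n, A k ω ∈ Set.Ioi
      (Real.exp (1 / star (Real.exp 1) (k + 1)))} := fun n =>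
    measurableSet_window (K := fun k => Set.Ioi (Real.exp (1 / star (Real.exp 1) (k + 1))))
      (fun k _ => hmeas k) fun _ => measurableSet_Ioi
  have h : ∀ ω, firstSmall (fun i => A i ω) = ∑' n, {ω | ∀ k < n, A k ω ∈ Set.Ioi
      (Real.exp (1 / star (Real.exp 1) (k + 1)))}.indicator (1 : Ω → ENNReal) ω := fun ω =>
    firstSmall_eq_tsum _
  simp_rw [h]
  rw [lintegral_tsum fun n => (measurable_one.indicator (hset n)).aemeasurable]
  congr 1
  ext n
  rw [lintegral_indicator_one (hset n)]
  have := measure_window hindep hident 0 n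
    (K := fun k => Set.Ioi (Real.exp (1 / star (Real.exp 1) (k + 1)))) fun _ => measurableSet_Ioi
  simpa only [zero_add, tailProb] using this

theorem tailProb_mono : Monotone (tailProb P A) := by
  intro k l hkl
  refine measure_mono (Set.preimage_mono (Set.Ioi_subset_Ioi (Real.exp_le_exp.mpr ?_)))
  exact one_div_le_one_div_of_le (star_exp_pos _) (star_exp_monotone (by omega))

/-- Borel–Cantelli, applied to the events `F n` that no entry met when reading down from level `n`
falls below its threshold, with thresholds shifted by `c`. -/
theorem ae_bounded_of_lintegral_lt_top [IsProbabilityMeasure P] (hmeas : ∀ n, Measurable (A n))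
    (hindep : iIndepFun A P) (hident : ∀ n, IdentDistrib (A n) (A 0) P P) {b : ℝ} (hb : 1 ≤ b)
    (hA : ∀ᵐ ω ∂P, ∀ n, A n ω ∈ Set.Icc 1 b)
    (hlarge : P (A 0 ⁻¹' Set.Ioi (Real.exp (1 / Real.exp 1))) ≠ 0)
    (hfin : ∫⁻ ω, firstSmall (fun i => A i ω) ∂P < ⊤) :
    ∀ᵐ ω ∂P, ∃ M, ∀ n, towerOn n (fun i => A i ω) 1 ≤ M := by
  rw [lintegral_firstSmall hmeas hindep hident] at hfin
  obtain ⟨c, hc⟩ := exists_nat_ge (max (4 * Real.log b ^ 2) (Real.exp 1 ^ 2))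
  have hcs : (c : ℝ) ≤ star (Real.exp 1) c := by linarith [succ_le_star_exp c]
  have hc1 := ((le_max_left _ _).trans hc).trans hcs
  have hc2 := ((le_max_right _ _).trans hc).trans hcs
  have hp0 : tailProb P A 0 ≠ 0 := by
    rw [tailProb, star_exp_succ]
    simpa [star, powerTower] using hlarge
  have hpk : ∀ k, tailProb P A k ≠ 0 := fun k h =>
    hp0 (le_zero_iff.mp (h ▸ tailProb_mono (Nat.zero_le k)))
  set F : ℕ → Set Ω := fun n => {ω | ∀ j < n, A (n - 1 - j) ω ∈
    Set.Ioi (Real.exp (1 / star (Real.exp 1) (c + j + 1)))} with hF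
  have hPF : ∀ n, P (F n) = ∏ j ∈ Finset.range n, tailProb P A (c + j) := fun n =>
    measure_window_reverse hindep hident n
      (K := fun j => Set.Ioi (Real.exp (1 / star (Real.exp 1) (c + j + 1))))
      fun _ => measurableSet_Ioi
  have hsum : ∑' n, P (F n) ≠ ⊤ := by
    have hq : ∏ k ∈ Finset.range c, tailProb P A k ≠ 0 :=
      Finset.prod_ne_zero_iff.mpr fun k _ => hpk k
    -- Multiplied by the first `c` tail probabilities, which are nonzero, the shifted series becomes
    -- a subseries of the finite one.
    have hmul : (∏ k ∈ Finset.range c, tailProb P A k) * ∑' n, P (F n) ≠ ⊤ := by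
      rw [← ENNReal.tsum_mul_left]
      refine ne_top_of_le_ne_top hfin.ne ?_
      refine le_trans (le_of_eq ?_) (ENNReal.tsum_comp_le_tsum_of_injective
        (add_right_injective c) fun n => ∏ k ∈ Finset.range n, tailProb P A k)
      congr 1
      ext n
      rw [hPF, Finset.prod_range_add]
    exact (ENNReal.lt_top_of_mul_ne_top_right hmul hq).ne
  filter_upwards [ae_eventually_notMem hsum, hA] with ω hω hAω
  obtain ⟨n₀, hn₀⟩ := eventually_atTop.mp hω
  refine exists_towerOn_le_of_small hb hc1 hc2 hAω (n₀ := n₀) fun n hn => ?_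
  have := hn₀ n hn
  simp only [hF, Set.mem_ofPred_eq, Set.mem_Ioi, not_forall, not_lt] at this
  obtain ⟨j, hj, hle⟩ := this
  exact ⟨j, hj, by rwa [add_comm j c]⟩

/-! ### Boundedness implies finite expectation. -/

theorem measure_shift_tower_le
    (hindep : iIndepFun A P) (hident : ∀ n, IdentDistrib (A n) (A 0) P P) (i n : ℕ) (M : ℝ) :
    P {ω | towerOn n (fun j => A (j + i) ω) 1 ≤ M} = P {ω | towerOn n (fun j => A j ω) 1 ≤ M} := by
  have hid : IdentDistrib (fun ω j => A (j + i) ω) (fun ω j => A j ω) P P :=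
    IdentDistrib.pi (fun j => (hident (j + i)).trans (hident j).symm)
      (hindep.precomp (add_left_injective i)) hindep
  exact hid.measure_mem_eq (s := {x : ℕ → ℝ | towerOn n x 1 ≤ M})
    (measurableSet_le (measurable_towerOn (X := fun i (x : ℕ → ℝ) => x i)
      (fun i _ => measurable_pi_apply i) 1) measurable_const)

/-- The levels that follow `c₀` entries above `β` and then entries above the thresholds. -/
def survivalSet (β : ℝ) (c₀ k : ℕ) : Set ℝ :=
  if k < c₀ then Set.Ioi β else Set.Ioi (Real.exp (1 / star (Real.exp 1) (k - c₀ + 1)))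

theorem measurableSet_survivalSet (β : ℝ) (c₀ k : ℕ) : MeasurableSet (survivalSet β c₀ k) := by
  unfold survivalSet
  split_ifs <;> exact measurableSet_Ioi

/-- The `c₀` topmost entries raise the top geometrically to the starting height of
`le_towerOn_of_large`, which the remaining entries then maintain. -/
theorem lt_towerOn_of_survival {M β : ℝ} (hM : 3 ≤ M) (hβ : 1 ≤ β) {c₀ : ℕ}
    (hc₀ : M * star (Real.exp 1) 1 ^ 2 ≤ (Real.exp 1 * Real.log β) ^ c₀) {x : ℕ → ℝ} {m : ℕ}
    {t : ℝ} (ht : 1 ≤ t) (hx : ∀ k < m + c₀, x (m + c₀ - 1 - k) ∈ survivalSet β c₀ k) :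
    M < towerOn (m + c₀) x t := by
  rw [towerOn_add]
  have h1 : M * star (Real.exp 1) 1 ^ 2 ≤ towerOn c₀ (fun i => x (i + m)) t := by
    refine hc₀.trans (le_trans ?_ (pow_mul_le_towerOn hβ (zero_le_one.trans ht) fun i hi => ?_))
    · refine le_mul_of_one_le_right (le_trans ?_ hc₀) ht
      have := star_exp_pos 1
      positivity
    · have := hx (c₀ - 1 - i) (by omega)
      rwa [survivalSet, if_pos (by omega), show m + c₀ - 1 - (c₀ - 1 - i) = i + m by omega] at this
  have h2 := le_towerOn_of_large hM (x := x) (m := m) h1 fun k hk => by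
    have := hx (c₀ + k) (by omega)
    rwa [survivalSet, if_neg (by omega), show m + c₀ - 1 - (c₀ + k) = m - 1 - k by omega,
      Nat.add_sub_cancel_left] at this
  have h3 := succ_le_star_exp (m + 1)
  push_cast at h3
  have h4 : (0 : ℝ) ≤ m := Nat.cast_nonneg m
  have h5 : 1 < star (Real.exp 1) (m + 1) ^ 2 := one_lt_pow₀ (by linarith) two_ne_zero
  exact (lt_mul_of_one_lt_right (by linarith) h5).trans_le h2

theorem lintegral_lt_top_of_ae_bounded [IsProbabilityMeasure P] (hmeas : ∀ n, Measurable (A n))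
    (hindep : iIndepFun A P) (hident : ∀ n, IdentDistrib (A n) (A 0) P P)
    (hA : ∀ᵐ ω ∂P, ∀ n, 1 ≤ A n ω) {β : ℝ} (hβ : Real.exp (1 / Real.exp 1) < β)
    (hPβ : P (A 0 ⁻¹' Set.Ioi β) ≠ 0)
    (hbdd : ∀ᵐ ω ∂P, ∃ M, ∀ n, towerOn n (fun i => A i ω) 1 ≤ M) :
    ∫⁻ ω, firstSmall (fun i => A i ω) ∂P < ⊤ := by
  rw [lintegral_firstSmall hmeas hindep hident]
  have hβ1 : 1 ≤ β := (Real.one_le_exp (by positivity)).trans hβ.le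
  have hr : 1 < Real.exp 1 * Real.log β := by
    have := (Real.lt_log_iff_exp_lt (by linarith)).mpr hβ
    rwa [one_div, inv_lt_iff_one_lt_mul₀' (Real.exp_pos 1)] at this
  obtain ⟨M, hM3, hv⟩ : ∃ M : ℝ, 3 ≤ M ∧
      P {ω | ∀ n, towerOn n (fun i => A i ω) 1 ≤ M} ≠ 0 := by
    by_contra! hcon
    have h0 : P (⋃ k : ℕ, {ω | ∀ n, towerOn n (fun i => A i ω) 1 ≤ max 3 (k : ℝ)}) = 0 :=
      measure_iUnion_null fun k => hcon _ (le_max_left _ _)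
    have h1 : ∀ᵐ ω ∂P, False := by
      filter_upwards [hbdd, measure_eq_zero_iff_ae_notMem.mp h0] with ω ⟨M, hM⟩ hω
      obtain ⟨k, hk⟩ := exists_nat_ge M
      exact hω (Set.mem_iUnion.mpr ⟨k, fun n => (hM n).trans (hk.trans (le_max_right _ _))⟩)
    exact h1.exists.elim fun _ h => h
  set v := P {ω | ∀ n, towerOn n (fun i => A i ω) 1 ≤ M} with hvdef
  obtain ⟨c₀, hc₀, hc₀1⟩ := (((tendsto_pow_atTop_atTop_of_one_lt hr).eventually_ge_atTop
    (M * star (Real.exp 1) 1 ^ 2)).and (eventually_ge_atTop 1)).exists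
  -- `V N i` says that the tower from level `i` up to `N` is low; `Y i` says that the entries before
  -- `i`, read backwards, form a survival pattern. They depend on disjoint sets of entries, so their
  -- probabilities multiply.
  set V : ℕ → ℕ → Set Ω := fun N i => {ω | towerOn (N - i) (fun j => A (j + i) ω) 1 ≤ M} with hV
  set Y : ℕ → Set Ω := fun i => {ω | ∀ k < i, A (i - 1 - k) ω ∈ survivalSet β c₀ k} with hY
  have hVm : ∀ N i, MeasurableSet[sigmaOf A (Set.Ici i)] (V N i) := fun N i =>
    measurableSet_le (measurable_towerOn (m := sigmaOf A (Set.Ici i)) (X := fun j => A (j + i))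
      (fun j _ => measurable_sigmaOf (Set.mem_Ici.mpr (Nat.le_add_left i j))) 1) measurable_const
  have hYm : ∀ i, MeasurableSet[sigmaOf A (Set.Iio i)] (Y i) := fun i =>
    measurableSet_window (m := sigmaOf A (Set.Iio i)) (X := fun k => A (i - 1 - k))
      (fun k hk => measurable_sigmaOf (Set.mem_Iio.mpr (by omega)))
      (measurableSet_survivalSet β c₀)
  have hWm : ∀ N i, MeasurableSet (V N i ∩ Y i) := fun N i =>
    (sigmaOf_le hmeas _ _ (hVm N i)).inter (sigmaOf_le hmeas _ _ (hYm i))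
  have hPW : ∀ N m, v * (P (A 0 ⁻¹' Set.Ioi β) ^ c₀ * ∏ k ∈ Finset.range m, tailProb P A k) ≤
      P (V N (c₀ + m) ∩ Y (c₀ + m)) := by
    intro N m
    rw [measure_inter_sigmaOf hmeas hindep (Set.Iio_disjoint_Ici le_rfl).symm (hVm N _) (hYm _)]
    refine mul_le_mul' ?_ (le_of_eq ?_)
    · rw [hV, measure_shift_tower_le hindep hident]
      exact measure_mono fun ω hω => hω _
    · rw [hY, measure_window_reverse hindep hident _ (measurableSet_survivalSet β c₀),
        Finset.prod_range_add]
      congr 1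
      · rw [Finset.prod_congr rfl (g := fun _ => P (A 0 ⁻¹' Set.Ioi β)), Finset.prod_const,
          Finset.card_range]
        intro k hk
        rw [survivalSet, if_pos (Finset.mem_range.mp hk)]
      · refine Finset.prod_congr rfl fun k _ => ?_
        rw [survivalSet, if_neg (by omega), Nat.add_sub_cancel_left, tailProb]
  -- Pathwise, `V ∩ Y` holds for at most `c₀` levels. If `j` is the last one and `i + c₀ ≤ j`, the
  -- survival pattern ending at `j` makes the tower from `i` exceed `M`, contradicting `V` at `i`.
  have hcount : ∀ L, ∑ m ∈ Finset.range L,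
      P (V (c₀ + L) (c₀ + m) ∩ Y (c₀ + m)) ≤ c₀ := by
    intro L
    classical
    set W : ℕ → Set Ω := fun m => V (c₀ + L) (c₀ + m) ∩ Y (c₀ + m) with hW
    have hWm' : ∀ m, MeasurableSet (W m) := fun m => hWm _ _
    calc ∑ m ∈ Finset.range L, P (W m)
        = ∫⁻ ω, ∑ m ∈ Finset.range L, (W m).indicator 1 ω ∂P := by
          rw [lintegral_finsetSum _ fun m _ => measurable_one.indicator (hWm' m)]
          exact Finset.sum_congr rfl fun m _ => (lintegral_indicator_one (hWm' m)).symm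
      _ ≤ ∫⁻ _, (c₀ : ENNReal) ∂P := by
          refine lintegral_mono_ae ?_
          filter_upwards [hA] with ω hω
          have hcard : ∑ m ∈ Finset.range L, (W m).indicator (1 : Ω → ENNReal) ω =
              (((Finset.range L).filter fun m => ω ∈ W m).card : ENNReal) := by
            rw [Finset.card_filter, Nat.cast_sum]
            refine Finset.sum_congr rfl fun m _ => ?_
            by_cases h : ω ∈ W m <;> simp [h]
          rw [hcard, Nat.cast_le]
          rcases ((Finset.range L).filter fun m => ω ∈ W m).eq_empty_or_nonempty with he | hne
          · rw [he]; exact Nat.zero_le _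
          set s := (Finset.range L).filter fun m => ω ∈ W m
          set j := s.max' hne with hj
          have hjs : j ∈ s := s.max'_mem hne
          have hjL := Finset.mem_range.mp (Finset.mem_filter.mp hjs).1
          have hjW := (Finset.mem_filter.mp hjs).2
          have hsub : s ⊆ Finset.Ico (j + 1 - c₀) (j + 1) := by
            intro i hi
            have hij : i ≤ j := s.le_max' i hi
            have hiW := (Finset.mem_filter.mp hi).2
            rw [Finset.mem_Ico]
            refine ⟨?_, by omega⟩
            by_contra hcon
            obtain ⟨m, hm⟩ := Nat.exists_eq_add_of_le' (show i + c₀ ≤ j by omega)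
            have hVi : towerOn (c₀ + L - (c₀ + i)) (fun k => A (k + (c₀ + i)) ω) 1 ≤ M := hiW.1
            have hYj : ∀ k < c₀ + j, A (c₀ + j - 1 - k) ω ∈ survivalSet β c₀ k := hjW.2
            rw [show c₀ + L - (c₀ + i) = (m + c₀) + (L - j) by omega, towerOn_add] at hVi
            refine absurd hVi (not_le.mpr (lt_towerOn_of_survival hM3 hβ1 hc₀
              (one_le_towerOn (fun k => hω _) le_rfl _) fun k hk => ?_))
            have := hYj k (by omega)
            rwa [show c₀ + j - 1 - k = m + c₀ - 1 - k + (c₀ + i) by omega] at this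
          refine (Finset.card_le_card hsub).trans ?_
          rw [Nat.card_Ico]
          omega
      _ = c₀ := by simp
  have hbound : v * (P (A 0 ⁻¹' Set.Ioi β) ^ c₀ *
      ∑' m, ∏ k ∈ Finset.range m, tailProb P A k) ≤ c₀ := by
    rw [← ENNReal.tsum_mul_left, ← ENNReal.tsum_mul_left]
    refine ENNReal.tsum_le_of_sum_range_le fun L => ?_
    exact (Finset.sum_le_sum fun m _ => hPW (c₀ + L) m).trans (hcount L)
  have h1 := ENNReal.lt_top_of_mul_ne_top_right
    (ne_top_of_le_ne_top (ENNReal.natCast_ne_top c₀) hbound) hv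
  exact ENNReal.lt_top_of_mul_ne_top_right h1.ne (pow_ne_zero _ hPβ)

end RandomPowerTower

/-! ### Assembly of the cases. -/

theorem mainTheorem1 {Ω : Type*} [MeasurableSpace Ω] (P : Measure Ω) [IsProbabilityMeasure P]
    (A : ℕ → Ω → ℝ) (hmeas : ∀ n, Measurable (A n))
    (hpos : ∀ n, ∀ᵐ ω ∂P, 0 < A n ω)
    (hindep : iIndepFun A P) (hident : ∀ n, IdentDistrib (A n) (A 0) P P)
    (a b : EReal) (ha : a = RandomPowerTower.suppInf (P.map (A 0)))
    (hb : b = RandomPowerTower.suppSup (P.map (A 0)))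
    (T : ℕ → Ω → ℝ) (hT : ∀ n ω, T n ω = RandomPowerTower.powerTower n (fun i => A i ω)) :
    (Set.Icc a b ⊆ Set.Icc (1 : EReal) ((Real.exp (1 / Real.exp 1) : ℝ) : EReal) →
      ∀ᵐ ω ∂P, ∃ l : ℝ, Tendsto (fun n => T n ω) atTop (𝓝 l)) ∧
    (1 ≤ a → b ∈ Set.Ioo ((Real.exp (1 / Real.exp 1) : ℝ) : EReal) ⊤ →
      (∫⁻ ω, RandomPowerTower.firstSmall (fun i => A i ω) ∂P < ⊤ ↔
        ∀ᵐ ω ∂P, ∃ l : ℝ, Tendsto (fun n => T n ω) atTop (𝓝 l))) ∧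
    (b ≤ 1 → a < ((RandomPowerTower.G b.toReal : ℝ) : EReal) →
      ∀ᵐ ω ∂P, ∃ l : ℝ, Tendsto (fun n => T n ω) atTop (𝓝 l)) ∧
    (b < ((Real.exp (-Real.exp 1) : ℝ) : EReal) →
      ((RandomPowerTower.G b.toReal : ℝ) : EReal) ≤ a →
      ∀ᵐ ω ∂P, ∃ l₀ l₁ : ℝ, Tendsto (fun n => T (2 * n) ω) atTop (𝓝 l₀) ∧
        Tendsto (fun n => T (2 * n + 1) ω) atTop (𝓝 l₁) ∧ l₀ ≠ l₁) ∧
    (a < 1 → 1 < b → ∀ᵐ ω ∂P, ∃ l : ℝ, Tendsto (fun n => T n ω) atTop (𝓝 l)) := by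
  open RandomPowerTower in
  have hTn : ∀ n ω, T n ω = towerOn n (fun i => A i ω) 1 := fun n ω => by
    rw [hT, powerTower_eq_towerOn]
  simp only [hTn]
  have hpos' : ∀ᵐ ω ∂P, ∀ n, 0 < A n ω := ae_all_iff.mpr hpos
  have hsupp0 := ae_mem_Icc_supp (P := P) (hmeas 0)
  rw [← ha, ← hb] at hsupp0
  have hsupp : ∀ᵐ ω ∂P, ∀ n, ((A n ω : ℝ) : EReal) ∈ Set.Icc a b :=
    ae_forall_mem hident (s := {z : ℝ | (z : EReal) ∈ Set.Icc a b})
      (measurable_coe_real_ereal measurableSet_Icc) hsupp0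
  have hIio : ∀ z : ℝ, a < z → P (A 0 ⁻¹' Set.Iio z) ≠ 0 := fun z hz =>
    measure_preimage_Iio_ne_zero (hmeas 0) (ha ▸ hz)
  have hIoi : ∀ z : ℝ, (z : EReal) < b → P (A 0 ⁻¹' Set.Ioi z) ≠ 0 := fun z hz =>
    measure_preimage_Ioi_ne_zero (hmeas 0) (hb ▸ hz)
  have hb0 : 0 < b := by
    obtain ⟨ω, hω, hω'⟩ := (hpos'.and hsupp0).exists
    exact (EReal.coe_pos.mpr (hω 0)).trans_le hω'.2
  have hreal : b < ⊤ → ∃ β : ℝ, 0 < β ∧ b = β := fun hbt => by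
    lift b to ℝ using ⟨hbt.ne, (bot_le.trans_lt hb0).ne'⟩
    exact ⟨b, EReal.coe_pos.mp hb0, rfl⟩
  refine ⟨fun h => ?_, fun ha1 hbI => ?_, fun hb1 haG => ?_, fun hbe haG => ?_, fun ha1 hb1 => ?_⟩
  · filter_upwards [hsupp] with ω hω
    have hx : ∀ i, A i ω ∈ Set.Icc 1 (Real.exp (1 / Real.exp 1)) := fun i =>
      ⟨EReal.coe_le_coe_iff.mp (h (hω i)).1, EReal.coe_le_coe_iff.mp (h (hω i)).2⟩
    exact exists_tendsto_of_one_le (fun i => (hx i).1) (towerOn_le_exp_one hx)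
  · obtain ⟨β, hβ0, rfl⟩ := hreal hbI.2
    have hA : ∀ᵐ ω ∂P, ∀ n, A n ω ∈ Set.Icc 1 β := by
      filter_upwards [hsupp] with ω hω n
      exact ⟨EReal.coe_le_coe_iff.mp (ha1.trans (hω n).1), EReal.coe_le_coe_iff.mp (hω n).2⟩
    have hβ := EReal.coe_lt_coe_iff.mp hbI.1
    constructor
    · intro hfin
      have hβ1 : 1 ≤ β := (Real.one_le_exp (by positivity)).trans hβ.le
      filter_upwards [hA, ae_bounded_of_lintegral_lt_top hmeas hindep hident hβ1 hA
        (hIoi _ hbI.1) hfin] with ω hω hM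
      obtain ⟨M, hM⟩ := hM
      exact exists_tendsto_of_one_le (fun i => (hω i).1) hM
    · intro hconv
      -- No mass lies above `b` itself, so the fast-growth entries are those above some `γ` strictly
      -- between `e ^ (1 / e)` and `b`.
      obtain ⟨γ, hγ, hγβ⟩ := exists_between hβ
      refine lintegral_lt_top_of_ae_bounded hmeas hindep hident
        (hA.mono fun ω hω n => (hω n).1) hγ (hIoi γ (EReal.coe_lt_coe_iff.mpr hγβ)) ?_
      filter_upwards [hconv] with ω hω
      obtain ⟨l, hl⟩ := hω
      obtain ⟨M, hM⟩ := hl.bddAbove_range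
      exact ⟨M, fun n => hM ⟨n, rfl⟩⟩
  · obtain ⟨β, hβ0, rfl⟩ := hreal (hb1.trans_lt (EReal.coe_lt_top 1))
    rw [EReal.toReal_coe] at haG
    obtain ⟨p, hap, hpG⟩ := EReal.lt_iff_exists_real_btwn.mp haG
    exact ae_exists_tendsto_of_lt_G hmeas hpos' hindep hident hβ0
      (EReal.coe_le_coe_iff.mp hb1)
      (hsupp.mono fun ω hω n => EReal.coe_le_coe_iff.mp (hω n).2)
      (fun q hq => hIoi q (EReal.coe_lt_coe_iff.mpr hq))
      (EReal.coe_lt_coe_iff.mp hpG) (hIio p hap)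
  · obtain ⟨β, hβ0, rfl⟩ := hreal (hbe.trans (EReal.coe_lt_top _))
    rw [EReal.toReal_coe] at haG
    filter_upwards [hsupp] with ω hω
    exact exists_tendsto_even_odd hβ0 (EReal.coe_lt_coe_iff.mp hbe) fun i =>
      ⟨EReal.coe_le_coe_iff.mp (haG.trans (hω i).1), EReal.coe_le_coe_iff.mp (hω i).2⟩
  · exact ae_exists_tendsto_of_lt_one_of_one_lt hmeas hpos' hindep hident
      (hIio 1 ha1) (hIoi 1 hb1)
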